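/- Let $M$ be a smooth surface and let $\mathcal A\subset TM\setminus 0$ be a conic sub-bundle: a non-empty open set, stable under $y\mapsto\lambda y$ for $\lambda>0$, that projects onto $M$. Let $F:\mathcal A\to\mathbb R$ be a conic pseudo-Finsler metric: $F$ is smooth, $F(x,\lambda y)=\lambda F(x,y)$ for $\lambda>0$, and $g_{ij}=\tfrac12\dot\partial_i\dot\partial_jF^2$ is non-degenerate on $\mathcal A$, where $(x^i,y^i)$ are the coordinates on $TM$ induced by a chart of $M$, $\partial_i=\partial/\partial x^i$ and $\dot\partial_i=\partial/\partial y^i$. In such coordinates let $$G^i=\tfrac14 g^{ij}\left(y^k\partial_k\dot\partial_jF^2-\partial_jF^2\right),\qquad G^j_i=\dot\partial_iG^j,\qquad \delta_i=\partial_i-G^j_i\dot\partial_j,$$ $$\mathfrak g=\det(g_{ij}),\quad \varepsilon=\operatorname{sgn}\mathfrak g,\quad \ell_i=\dot\partial_iF,\quad \ell^i=\frac{y^i}{F},\quad (m^1,m^2)=\frac{\varepsilon}{\sqrt{\varepsilon\mathfrak g}}(-\ell_2,\ell_1),\quad C_{ijk}=\tfrac12\dot\partial_kg_{ij},\quad \mathcal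 I=\varepsilon F\,C_{ijk}m^im^jm^k.$$ For a smooth function $f$ put $$f_{;2}=\varepsilon F(\dot\partial_if)m^i,\qquad f_{,1}=(\delta_if)\ell^i,\qquad f_{,2}=\varepsilon(\delta_if)m^i .$$ Let $\phi:\mathcal A\to\mathbb R$ be smooth with $\phi(x,\lambda y)=\phi(x,y)$ for $\lambda>0$ and $$F^2\left(\dot\partial_i\dot\partial_j\phi+(\dot\partial_i\phi)(\dot\partial_j\phi)\right)m^im^j+\varepsilon\neq0\quad\text{on }\mathcal A,$$ let $\overline F=e^{\phi}F$ be the corresponding anisotropic conformal change of $F$, and put $$\sigma=\phi_{;2;2}+\varepsilon\mathcal I\phi_{;2}+2(\phi_{;2})^2,\qquad \rho=\frac1{\sigma+\varepsilon-(\phi_{;2})^2},\qquad 2Q=\varepsilon\rho F^2\left(\phi_{;2}\phi_{,1}+\phi_{,1;2}-2\phi_{,2}\right).$$ Suppose that $F$ is pseudo-Riemannian, that is, $C_{ijk}=0$ on $\mathcal A$ (equivalently $\mathcal I=0$). Then $\overline F$ is of Douglas type, that is, its Douglas tensor $$\overline D^i_{jkl}=\dot\partial_j\dot\partial_k\dot\partial_l\left(\overline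 G^i-\tfrac13(\dot\partial_r\overline G^r)\,y^i\right)$$ (with $\overline G^i$ the functions $G^i$ formed from $\overline F$) vanishes identically on $\mathcal A$, if and only if $$9\varepsilon Q+10\,Q_{;2;2}+\varepsilon\,Q_{;2;2;2;2}=0\quad\text{on }\mathcal A,$$ where the subscripts ${}_{;2}$ are taken with respect to $F$. (Both conditions are required in the induced coordinates of every chart of $M$.) -/

import Mathlib

open scoped Manifold ContDiff

noncomputable section

namespace ConicFinsler

/-- Coordinate plane; the two coordinates are indexed by `0` and `1`. -/
abbrev Plane : Type := EuclideanSpace ℝ (Fin 2)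

/-! ### Calculus of functions `f(x, y)` of induced coordinates `(x, y)` on the tangent bundle -/

/-- `∂_i f = ∂f/∂x^i`. -/
def dx (i : Fin 2) (f : Plane × Plane → ℝ) (p : Plane × Plane) : ℝ :=
  fderiv ℝ f p (EuclideanSpace.single i 1, 0)

/-- `∂̇_i f = ∂f/∂y^i`. -/
def dy (i : Fin 2) (f : Plane × Plane → ℝ) (p : Plane × Plane) : ℝ :=
  fderiv ℝ f p (0, EuclideanSpace.single i 1)

section Local

variable (F : Plane × Plane → ℝ)

/-- Finsler metric tensor `g_ij = (1/2) ∂̇_i ∂̇_j F²`. -/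
def metric (p : Plane × Plane) : Matrix (Fin 2) (Fin 2) ℝ :=
  Matrix.of fun i j => (1 / 2) * dy i (dy j (fun q => F q ^ 2)) p

/-- Cartan tensor `C_ijk = (1/2) ∂̇_k g_ij`. -/
def cartan (i j k : Fin 2) (p : Plane × Plane) : ℝ :=
  (1 / 2) * dy k (fun q => metric F q i j) p

/-- Coefficients of the geodesic spray `S = y^i ∂_i - 2 G^i ∂̇_i` of `F`:
`G^i = (1/4) g^{ij} (y^k ∂_k ∂̇_j F² - ∂_j F²)`. -/
def spray (i : Fin 2) (p : Plane × Plane) : ℝ :=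
  (1 / 4) * ∑ j, (metric F p)⁻¹ i j *
    ((∑ k, p.2 k * dx k (dy j (fun q => F q ^ 2)) p) - dx j (fun q => F q ^ 2) p)

/-- Barthel connection `G^j_i = ∂̇_i G^j`. -/
def barthel (j i : Fin 2) (p : Plane × Plane) : ℝ := dy i (spray F j) p

/-- Douglas tensor
`D^i_jkl = ∂̇_j ∂̇_k ∂̇_l (G^i - (1/(n+1)) (∂̇_r G^r) y^i)` with `n = 2`. -/
def douglas (i j k l : Fin 2) (p : Plane × Plane) : ℝ :=
  dy j (dy k (dy l (fun q => spray F i q - (1 / 3) * (∑ r, dy r (spray F r) q) * q.2 i))) p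

/-- `ε = ±1`, the sign of `det (g_ij)`. -/
def eps (p : Plane × Plane) : ℝ := Real.sign (metric F p).det

/-- `ℓ_i = ∂̇_i F`. -/
def ellDown (i : Fin 2) (p : Plane × Plane) : ℝ := dy i F p

/-- `ℓ^i = y^i / F`. -/
def ellUp (i : Fin 2) (p : Plane × Plane) : ℝ := p.2 i / F p

/-- `(m^1, m^2) = (ε / √(ε det g)) (-ℓ_2, ℓ_1)`. -/
def mUp (i : Fin 2) (p : Plane × Plane) : ℝ :=
  eps F p / √(eps F p * (metric F p).det) * ![-ellDown F 1 p, ellDown F 0 p] i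

/-- Main scalar `𝓘`, defined by `F C_ijk = 𝓘 m_i m_j m_k`; since `m^i m_i = ε` this means
`𝓘 = ε F C_ijk m^i m^j m^k`. -/
def mainScalar (p : Plane × Plane) : ℝ :=
  eps F p * F p * ∑ i, ∑ j, ∑ k, cartan F i j k p * mUp F i p * mUp F j p * mUp F k p

/-- `δ_i f = ∂_i f - G^j_i ∂̇_j f`. -/
def delta (i : Fin 2) (f : Plane × Plane → ℝ) (p : Plane × Plane) : ℝ :=
  dx i f p - ∑ j, barthel F j i p * dy j f p

/-- v-scalar derivative `f_{;2} = ε F (∂̇_i f) m^i`. -/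
def v2 (f : Plane × Plane → ℝ) (p : Plane × Plane) : ℝ :=
  eps F p * F p * ∑ i, dy i f p * mUp F i p

/-- h-scalar derivative `f_{,1} = (δ_i f) ℓ^i`. -/
def h1 (f : Plane × Plane → ℝ) (p : Plane × Plane) : ℝ :=
  ∑ i, delta F i f p * ellUp F i p

/-- h-scalar derivative `f_{,2} = ε (δ_i f) m^i`. -/
def h2 (f : Plane × Plane → ℝ) (p : Plane × Plane) : ℝ :=
  eps F p * ∑ i, delta F i f p * mUp F i p

/-- `σ = φ_{;2;2} + ε 𝓘 φ_{;2} + 2 (φ_{;2})²`. -/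
def sigma (φ : Plane × Plane → ℝ) (p : Plane × Plane) : ℝ :=
  v2 F (v2 F φ) p + eps F p * mainScalar F p * v2 F φ p + 2 * v2 F φ p ^ 2

/-- `ρ = 1 / (σ + ε - (φ_{;2})²)`. -/
def rho (φ : Plane × Plane → ℝ) (p : Plane × Plane) : ℝ :=
  1 / (sigma F φ p + eps F p - v2 F φ p ^ 2)

/-- The function `Q` attached to the change `F ↦ e^φ F`:
`2 Q = ε ρ F² (φ_{;2} φ_{,1} + φ_{,1;2} - 2 φ_{,2})`. -/
def Q (φ : Plane × Plane → ℝ) (p : Plane × Plane) : ℝ :=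
  (1 / 2) * (eps F p * rho F φ p * F p ^ 2 *
    (v2 F φ p * h1 F φ p + v2 F (h1 F φ) p - 2 * h2 F φ p))

/-- `F² (∂̇_i ∂̇_j φ + (∂̇_i φ) (∂̇_j φ)) m^i m^j + ε`. -/
def changeDiscriminant (φ : Plane × Plane → ℝ) (p : Plane × Plane) : ℝ :=
  F p ^ 2 * (∑ i, ∑ j, (dy i (dy j φ) p + dy i φ p * dy j φ p) * mUp F i p * mUp F j p) + eps F p

end Local

/-! ### Objects on a smooth surface `M` -/

section Global

variable {M : Type*} [TopologicalSpace M] [ChartedSpace Plane M]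

/-- The point of `TM` with induced coordinates `p = (x, y)` in the chart `e`. -/
def tangentPoint (e : OpenPartialHomeomorph M Plane) (p : Plane × Plane) :
    TangentBundle (𝓡 2) M :=
  ⟨e.symm p.1, mfderiv (𝓡 2) (𝓡 2) e.symm p.1 p.2⟩

/-- The expression `f(x, y)` of a function on `TM` in the coordinates induced by `e`. -/
def localRep (e : OpenPartialHomeomorph M Plane) (f : TangentBundle (𝓡 2) M → ℝ) :
    Plane × Plane → ℝ :=
  fun p => f (tangentPoint e p)

/-- The set of induced coordinates, in the chart `e`, of the points of `A`. -/
def localDomain (e : OpenPartialHomeomorph M Plane) (A : Set (TangentBundle (𝓡 2) M)) :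
    Set (Plane × Plane) :=
  {p | p.1 ∈ e.target ∧ tangentPoint e p ∈ A}

/-- `λ v` for a tangent vector `v`. -/
def scale (c : ℝ) (v : TangentBundle (𝓡 2) M) : TangentBundle (𝓡 2) M := ⟨v.1, c • v.2⟩

/-- `f` is positively homogeneous of degree `r` in `y` on `A`. -/
def IsPosHomogeneousOn (r : ℕ) (f : TangentBundle (𝓡 2) M → ℝ)
    (A : Set (TangentBundle (𝓡 2) M)) : Prop :=
  ∀ v ∈ A, ∀ c : ℝ, 0 < c → f (scale c v) = c ^ r * f v

variable [IsManifold (𝓡 2) ∞ M]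

/-- A conic sub-bundle of `TM`: a non-empty open set of nonzero tangent vectors, stable under
multiplication by positive reals, that projects onto `M`. -/
structure IsConicSubbundle (A : Set (TangentBundle (𝓡 2) M)) : Prop where
  nonempty : A.Nonempty
  isOpen : IsOpen A
  ne_zero : ∀ v ∈ A, v.2 ≠ 0
  scale_mem : ∀ v ∈ A, ∀ c : ℝ, 0 < c → scale c v ∈ A
  proj_image : (fun v : TangentBundle (𝓡 2) M => v.1) '' A = Set.univ

/-- `F : A → ℝ` is a conic pseudo-Finsler metric on the surface `M`. -/
structure IsConicPseudoFinsler (A : Set (TangentBundle (𝓡 2) M))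
    (F : TangentBundle (𝓡 2) M → ℝ) : Prop where
  conic : IsConicSubbundle A
  smooth : ContMDiffOn (𝓡 2).tangent 𝓘(ℝ, ℝ) ∞ F A
  homogeneous : IsPosHomogeneousOn 1 F A
  nondegenerate : ∀ e ∈ IsManifold.maximalAtlas (𝓡 2) ∞ M, ∀ p ∈ localDomain e A,
    (metric (localRep e F) p).det ≠ 0

/-- A conic pseudo-Finsler metric is pseudo-Riemannian if its Cartan tensor vanishes
(`g_ij` does not depend on `y`), that is, if its main scalar vanishes. -/
structure IsConicPseudoRiemannian (A : Set (TangentBundle (𝓡 2) M))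
    (F : TangentBundle (𝓡 2) M → ℝ) : Prop extends IsConicPseudoFinsler A F where
  cartan_eq_zero : ∀ e ∈ IsManifold.maximalAtlas (𝓡 2) ∞ M, ∀ p ∈ localDomain e A,
    ∀ i j k, cartan (localRep e F) i j k p = 0

/-- `φ` is the conformal factor of an anisotropic conformal change `F ↦ e^φ F`. -/
structure IsAnisotropicConformalFactor (A : Set (TangentBundle (𝓡 2) M))
    (F φ : TangentBundle (𝓡 2) M → ℝ) : Prop where
  smooth : ContMDiffOn (𝓡 2).tangent 𝓘(ℝ, ℝ) ∞ φ A
  homogeneous : IsPosHomogeneousOn 0 φ A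
  discriminant_ne_zero : ∀ e ∈ IsManifold.maximalAtlas (𝓡 2) ∞ M, ∀ p ∈ localDomain e A,
    changeDiscriminant (localRep e F) (localRep e φ) p ≠ 0

/-- `F̄ = e^φ F`. -/
def conformalChange (F φ : TangentBundle (𝓡 2) M → ℝ) : TangentBundle (𝓡 2) M → ℝ :=
  fun v => Real.exp (φ v) * F v

/-- `F` is of Douglas type on `A`: its Douglas tensor vanishes identically. -/
def IsDouglas (A : Set (TangentBundle (𝓡 2) M)) (F : TangentBundle (𝓡 2) M → ℝ) : Prop :=
  ∀ e ∈ IsManifold.maximalAtlas (𝓡 2) ∞ M, ∀ p ∈ localDomain e A,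
    ∀ i j k l, douglas (localRep e F) i j k l p = 0

end Global

end ConicFinsler

end

/-!
The equivalence is local and even pointwise in each chart. Let `L = F² = g_ij(x) y^i y^j`, where
`g_ij` does not depend on `y` because the Cartan tensor vanishes, and let `J y = ε F m` be the
fibre coordinate turned by a quarter turn with respect to `g`. Then `J² = -ε`, and `f ↦ f_{;2}` is
the derivative `D` along the linear vector field `J y` of the fibres.

*The spray of `e^φ F`.* Let `S` be the spray of `F` and `δ_i` its horizontal derivatives. Since `J`
is parallel, `[D, S] = (J y)^i δ_i`, and all three operators annihilate `L`. Testing the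
Euler-Lagrange equations of `e^{2φ} L` on the vectors `y` and `J y` gives
`Ḡ^i = G^i + a y^i + b (J y)^i` with
`2 (φ_{;2;2} + (φ_{;2})² + ε) b = φ_{;2} Sφ + S φ_{;2} - (J y)^i δ_i φ`
(`ConformalCalculus.spray_equation`). The hypothesis on the change makes the coefficient of `b`
non-zero, which is also the non-degeneracy of `e^φ F` (`ConformalCalculus.det_hessian_vL`), and a
commutation turns the formula into `b = ε Q / F` (`IsLocalConformalFactor.represents_Q`).

*The Douglas tensor.* `G^i` is quadratic in `y`, and the terms in `a` cancel by homogeneity, so the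
Douglas tensor of `e^φ F` consists of the third fibre derivatives of
`P^i = b (J y)^i - (1/3) (D b) y^i`, a function of degree two. The third derivatives of a function
`f` of degree two on a plane are annihilated by `y`, so they are determined by their value
`D³ f + 4 ε D f` on `J y` (`RiemannianCalculus.third_eq`). For `f = P^i` this value is
`-(1/3) (9 b + 10 ε D² b + D⁴ b) y^i` (`ConformalCalculus.D_D_D_P`). As `D F = 0` and `y ≠ 0`, it
vanishes exactly when the equation for `Q` holds.

These are identities between functions and their derivatives. They are proved in an arbitrary
commutative `ℝ`-algebra with derivations playing the role of `∂/∂x^i` and `∂/∂y^i`, without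
denominators: `N = 4 G`, `T = 2 S`, `H = 2 (J y)^i δ_i`, `α = 4 a`, `β = 4 b`. They are then applied
to the algebra `SmoothFun U` of smooth functions on an open set `U` of induced coordinates; the
relation `Represents` connects a function on the whole coordinate space with its restriction to `U`.
-/

noncomputable section

/-! ### Pseudo-Riemannian metrics of dimension two -/

namespace ConicFinsler

/-- The differential calculus of functions of induced coordinates `(x, y)`, in algebraic form: a
commutative `ℝ`-algebra `R`, thought of as an algebra of smooth functions of `(x, y)`, with the
derivations `X i = ∂/∂x^i` and `Y i = ∂/∂y^i` and the fibre coordinates `y i`. Only the commutation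
rules that the computations use are recorded. -/
structure TangentCalculus (R : Type*) [CommRing R] [Algebra ℝ R] where
  /-- `∂/∂x^i` -/
  X : Fin 2 → Derivation ℝ R R
  /-- `∂/∂y^i` -/
  Y : Fin 2 → Derivation ℝ R R
  /-- the fibre coordinate `y^i` -/
  y : Fin 2 → R
  X_Y : ∀ i j f, X i (Y j f) = Y j (X i f)
  Y_Y : ∀ i j f, Y i (Y j f) = Y j (Y i f)
  X_y : ∀ i j, X i (y j) = 0
  Y_y : ∀ i j, Y i (y j) = if i = j then 1 else 0

/-- A pseudo-Riemannian metric in algebraic form: `L = F² = g_ij y^i y^j` with `g_ij` independent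
of `y`, together with the inverses of `det g` and `L`, the sign `ε` of `det g`, and
`w = 1 / √(ε det g)`, the latter characterized by `w² = ε / det g`. -/
structure RiemannianCalculus (R : Type*) [CommRing R] [Algebra ℝ R] extends
    TangentCalculus R where
  /-- `F²` -/
  L : R
  /-- the metric tensor -/
  g : Fin 2 → Fin 2 → R
  /-- the sign of `det g` -/
  ε : R
  /-- `1 / det g` -/
  detInv : R
  /-- `1 / √(ε det g)` -/
  w : R
  /-- `1 / F²` -/
  LInv : R
  g_symm : g 1 0 = g 0 1
  Y_g : ∀ i j k, Y k (g i j) = 0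
  Y_L : ∀ i, Y i L = 2 * (g i 0 * y 0 + g i 1 * y 1)
  L_eq : L = g 0 0 * y 0 ^ 2 + 2 * (g 0 1 * (y 0 * y 1)) + g 1 1 * y 1 ^ 2
  det_mul : (g 0 0 * g 1 1 - g 0 1 ^ 2) * detInv = 1
  ε_sq : ε ^ 2 = 1
  w_sq : w ^ 2 = ε * detInv
  L_mul : L * LInv = 1

variable {R : Type*} [CommRing R] [Algebra ℝ R]

theorem eq_zero_of_two_mul {a : R} (h : 2 * a = 0) : a = 0 := by
  have : a = (1 / 2 : ℝ) • (2 * a) := by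
    rw [two_mul, ← two_smul ℝ a, smul_smul]; norm_num
  rw [this, h, smul_zero]

theorem derivation_two (d : Derivation ℝ R R) : d 2 = 0 := by
  exact_mod_cast d.map_natCast 2

namespace RiemannianCalculus

variable (c : RiemannianCalculus R)

/-- A square root of `1` is annihilated by every derivation. For functions this says that `ε` is
locally constant. -/
theorem derivation_ε (d : Derivation ℝ R R) : d c.ε = 0 := by
  have h := congrArg d c.ε_sq
  simp only [Derivation.leibniz_pow, Derivation.map_one_eq_zero, smul_eq_mul, nsmul_eq_mul] at h
  apply eq_zero_of_two_mul
  push_cast at h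
  linear_combination c.ε * h - 2 * d c.ε * c.ε_sq

theorem derivation_detInv (d : Derivation ℝ R R) :
    d c.detInv = - c.detInv ^ 2 * d (c.g 0 0 * c.g 1 1 - c.g 0 1 ^ 2) := by
  have h := congrArg d c.det_mul
  rw [Derivation.leibniz, Derivation.map_one_eq_zero, smul_eq_mul, smul_eq_mul] at h
  linear_combination c.detInv * h - d c.detInv * c.det_mul

theorem w_sq_mul : c.w ^ 2 * (c.ε * (c.g 0 0 * c.g 1 1 - c.g 0 1 ^ 2)) = 1 := by
  rw [c.w_sq]
  linear_combination c.ε ^ 2 * c.det_mul + c.ε_sq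

theorem two_mul_derivation_w (d : Derivation ℝ R R) :
    2 * d c.w = - c.w * c.detInv * d (c.g 0 0 * c.g 1 1 - c.g 0 1 ^ 2) := by
  have h := congrArg d c.w_sq
  simp only [Derivation.leibniz_pow, Derivation.leibniz, smul_eq_mul, nsmul_eq_mul,
    c.derivation_ε, c.derivation_detInv, mul_zero, add_zero] at h
  push_cast at h
  have h1 := c.w_sq_mul
  have h2 := c.w_sq
  linear_combination c.w * c.ε * (c.g 0 0 * c.g 1 1 - c.g 0 1 ^ 2) * h - 2 * d c.w * h1
    - d (c.g 0 0 * c.g 1 1 - c.g 0 1 ^ 2) * c.w * c.detInv ^ 2 * (c.g 0 0 * c.g 1 1 - c.g 0 1 ^ 2)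
      * c.ε_sq
    - d (c.g 0 0 * c.g 1 1 - c.g 0 1 ^ 2) * c.w * c.detInv * c.det_mul

theorem Y_det (i : Fin 2) : c.Y i (c.g 0 0 * c.g 1 1 - c.g 0 1 ^ 2) = 0 := by
  simp [c.Y_g, Derivation.leibniz_pow]

theorem Y_detInv (i : Fin 2) : c.Y i c.detInv = 0 := by
  rw [derivation_detInv, Y_det, mul_zero]

theorem Y_w (i : Fin 2) : c.Y i c.w = 0 :=
  eq_zero_of_two_mul (by rw [two_mul_derivation_w, Y_det, mul_zero])

theorem Y_X_g (i j k l : Fin 2) : c.Y i (c.X j (c.g k l)) = 0 := by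
  rw [← c.X_Y, c.Y_g, map_zero]

/-- The lowered coordinate `y_i = g_ij y^j = F ℓ_i`. -/
def low (i : Fin 2) : R := c.g i 0 * c.y 0 + c.g i 1 * c.y 1

/-- The vector `J y = w (-y_1, y_0)`: the fibre coordinate turned by a quarter (Euclidean or
Lorentzian) turn. It equals `ε F m^i`. -/
def J : Fin 2 → R := ![-(c.w * c.low 1), c.w * c.low 0]

/-- The fibre derivative along `J y`; on functions it is `f ↦ f_{;2}`. -/
def D : Derivation ℝ R R := c.J 0 • c.Y 0 + c.J 1 • c.Y 1

/-- The Liouville field `y^i ∂̇_i`. -/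
def euler : Derivation ℝ R R := c.y 0 • c.Y 0 + c.y 1 • c.Y 1

/-- `y^k ∂_k ∂̇_j F² - ∂_j F²`. -/
def sprayLow (j : Fin 2) : R :=
  (c.y 0 * c.X 0 (c.Y j c.L) + c.y 1 * c.X 1 (c.Y j c.L)) - c.X j c.L

/-- Four times the spray coefficients: `N^i = 4 G^i = g^{ij} (y^k ∂_k ∂̇_j F² - ∂_j F²)`. The factor
avoids denominators in `R`. -/
def N : Fin 2 → R :=
  ![c.detInv * (c.g 1 1 * c.sprayLow 0 - c.g 0 1 * c.sprayLow 1),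
    c.detInv * (c.g 0 0 * c.sprayLow 1 - c.g 0 1 * c.sprayLow 0)]

/-- Twice the spray: `T = 2 S`, where `S = y^k ∂_k - 2 G^k ∂̇_k`. -/
def T : Derivation ℝ R R :=
  (2 * c.y 0) • c.X 0 + (2 * c.y 1) • c.X 1 - c.N 0 • c.Y 0 - c.N 1 • c.Y 1

/-- Twice the horizontal lift of `J y`, that is `2 (J y)^i δ_i`. The vertical part is written as
`T (J y)` instead of `-2 (J y)^i G^k_i`; the two agree by `two_mul_T_J`. -/
def H : Derivation ℝ R R :=
  (2 * c.J 0) • c.X 0 + (2 * c.J 1) • c.X 1 + c.T (c.J 0) • c.Y 0 + c.T (c.J 1) • c.Y 1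

theorem D_apply (f : R) : c.D f = c.J 0 * c.Y 0 f + c.J 1 * c.Y 1 f := by simp [D]

theorem euler_apply (f : R) : c.euler f = c.y 0 * c.Y 0 f + c.y 1 * c.Y 1 f := by simp [euler]

theorem metric_mul_N (j : Fin 2) : c.g j 0 * c.N 0 + c.g j 1 * c.N 1 = c.sprayLow j := by
  fin_cases j
  · simp [N]
    linear_combination c.sprayLow 0 * c.det_mul
  · simp [N, c.g_symm]
    linear_combination c.sprayLow 1 * c.det_mul

theorem T_apply (f : R) : c.T f =
    2 * c.y 0 * c.X 0 f + 2 * c.y 1 * c.X 1 f - c.N 0 * c.Y 0 f - c.N 1 * c.Y 1 f := by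
  simp [T]

theorem H_apply (f : R) : c.H f = 2 * c.J 0 * c.X 0 f + 2 * c.J 1 * c.X 1 f
    + c.T (c.J 0) * c.Y 0 f + c.T (c.J 1) * c.Y 1 f := by
  simp [H]

theorem D_y (i : Fin 2) : c.D (c.y i) = c.J i := by
  fin_cases i <;> simp [D_apply, c.Y_y]

theorem Y_low (i j : Fin 2) : c.Y i (c.low j) = c.g j i := by
  fin_cases i <;> simp [low, c.Y_y, c.Y_g]

/-- `J² = -ε`. -/
theorem D_J (i : Fin 2) : c.D (c.J i) = - (c.ε * c.y i) := by
  have h1 := c.w_sq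
  have h2 := c.det_mul
  have h3 := c.g_symm
  fin_cases i
  · simp [D_apply, J, c.Y_low, c.Y_w]
    simp only [low, h3]
    linear_combination (-(c.g 0 0 * c.g 1 1 - c.g 0 1 ^ 2) * c.y 0) * h1 - c.ε * c.y 0 * h2
  · simp [D_apply, J, c.Y_low, c.Y_w]
    simp only [low, h3]
    linear_combination (-(c.g 0 0 * c.g 1 1 - c.g 0 1 ^ 2) * c.y 1) * h1 - c.ε * c.y 1 * h2

theorem D_L : c.D c.L = 0 := by
  simp [D_apply, J, c.Y_L, low]
  ring

theorem euler_J (i : Fin 2) : c.euler (c.J i) = c.J i := by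
  fin_cases i <;> simp [euler_apply, J, c.Y_low, c.Y_w] <;> simp only [low] <;> ring

theorem sprayLow_eq (j : Fin 2) : c.sprayLow j =
    2 * (c.y 0 * c.X 0 (c.low j) + c.y 1 * c.X 1 (c.low j))
      - (c.y 0 ^ 2 * c.X j (c.g 0 0) + 2 * (c.y 0 * c.y 1 * c.X j (c.g 0 1))
        + c.y 1 ^ 2 * c.X j (c.g 1 1)) := by
  simp [sprayLow, c.Y_L, low, c.X_y, derivation_two]
  rw [c.L_eq]
  simp [c.X_y, Derivation.leibniz_pow, derivation_two]
  ring

theorem X_low (i j : Fin 2) :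
    c.X i (c.low j) = c.X i (c.g j 0) * c.y 0 + c.X i (c.g j 1) * c.y 1 := by
  simp [low, c.X_y]; ring

theorem Y_sprayLow (i j : Fin 2) : c.Y i (c.sprayLow j) =
    2 * (c.X i (c.low j) + c.y 0 * c.X 0 (c.g j i) + c.y 1 * c.X 1 (c.g j i)
      - c.X j (c.low i)) := by
  have h3 := c.g_symm
  rw [sprayLow_eq]
  simp only [X_low]
  fin_cases i <;> fin_cases j <;>
  simp [c.Y_y, c.Y_X_g, Derivation.leibniz_pow, h3, derivation_two] <;> ring

/-- The endomorphism `J` is parallel, in the form needed here: its derivative along the spray is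
`S (J y)^i = - (J y)^l G^i_l`. -/
theorem two_mul_T_J (i : Fin 2) : 2 * c.T (c.J i) = - c.D (c.N i) := by
  have h2 := c.det_mul
  have h3 := c.g_symm
  have e0 := c.two_mul_derivation_w (c.X 0)
  have e1 := c.two_mul_derivation_w (c.X 1)
  simp only [map_sub, Derivation.leibniz_pow, Derivation.leibniz, smul_eq_mul, nsmul_eq_mul]
    at e0 e1
  push_cast at e0 e1
  -- The terms without `detInv` and those with it cancel once `det g * detInv = 1` is used; the
  -- derivatives of `w` are eliminated through those of `det g`.
  fin_cases i
  · simp [T_apply, D_apply, J, N, c.Y_low, c.Y_w, c.Y_detInv, c.Y_sprayLow, c.Y_g, c.X_low, h3]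
    simp only [c.sprayLow_eq, c.X_low]
    simp only [low, h3]
    linear_combination (-2 * c.y 0 * (c.g 0 1 * c.y 0 + c.g 1 1 * c.y 1)) * e0
      + (-2 * c.y 1 * (c.g 0 1 * c.y 0 + c.g 1 1 * c.y 1)) * e1
      + (4 * c.w * (c.y 0 * (c.X 0 (c.g 0 1) * c.y 0 + c.X 0 (c.g 1 1) * c.y 1)
        + c.y 1 * (c.X 1 (c.g 0 1) * c.y 0 + c.X 1 (c.g 1 1) * c.y 1))) * h2
  · simp [T_apply, D_apply, J, N, c.Y_low, c.Y_w, c.Y_detInv, c.Y_sprayLow, c.Y_g, c.X_low, h3]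
    simp only [c.sprayLow_eq, c.X_low]
    simp only [low, h3]
    linear_combination (2 * c.y 0 * (c.g 0 0 * c.y 0 + c.g 0 1 * c.y 1)) * e0
      + (2 * c.y 1 * (c.g 0 0 * c.y 0 + c.g 0 1 * c.y 1)) * e1
      - (4 * c.w * (c.y 0 * (c.X 0 (c.g 0 0) * c.y 0 + c.X 0 (c.g 0 1) * c.y 1)
        + c.y 1 * (c.X 1 (c.g 0 0) * c.y 0 + c.X 1 (c.g 0 1) * c.y 1))) * h2

/-- The spray of a pseudo-Riemannian metric is quadratic in `y`. -/
theorem Y_Y_Y_N (i j k l : Fin 2) : c.Y i (c.Y j (c.Y k (c.N l))) = 0 := by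
  have h (i j k m : Fin 2) : c.Y i (c.Y j (c.Y k (c.sprayLow m))) = 0 := by
    simp only [Y_sprayLow, X_low]
    simp only [c.Y_y, c.Y_X_g, derivation_two, map_add, map_sub, Derivation.leibniz, smul_eq_mul,
      mul_zero, zero_add, add_zero]
    split_ifs <;> simp
  fin_cases l <;> simp [N, h, c.Y_detInv, c.Y_g]

/-- The Euler-Lagrange equation `S (∂̇_j F²) = ∂_j F²`. -/
theorem T_Y_L (j : Fin 2) : c.T (c.Y j c.L) = 2 * c.X j c.L := by
  have h2 := c.det_mul
  have h3 := c.g_symm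
  have e (i : Fin 2) : c.Y i (c.Y j c.L) = 2 * c.g j i := by
    rw [c.Y_L]; exact (by simp [c.Y_g, c.Y_y, derivation_two]; fin_cases i <;> simp)
  have e2 : 2 * c.y 0 * c.X 0 (c.Y j c.L) + 2 * c.y 1 * c.X 1 (c.Y j c.L)
    = 2 * c.sprayLow j + 2 * c.X j c.L := by simp only [sprayLow]; ring
  rw [T_apply, e, e, e2]
  fin_cases j
  · simp [N]
    linear_combination (-2 * c.sprayLow 0) * h2
  · simp [N, h3]
    linear_combination (-2 * c.sprayLow 1) * h2

/-- The commutation rule `[D, S] = (J y)^i δ_i`. -/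
theorem D_T (f : R) : c.D (c.T f) = c.T (c.D f) + c.H f := by
  have k0 := c.two_mul_T_J 0
  have k1 := c.two_mul_T_J 1
  rw [D_apply] at k0 k1
  simp only [D_apply, c.T_apply f, H_apply, map_add, map_sub, Derivation.leibniz, smul_eq_mul,
    c.Y_y, derivation_two]
  simp only [c.T_apply (c.Y 0 f), c.T_apply (c.Y 1 f), c.X_Y, c.Y_Y 1 0]
  simp
  linear_combination -c.Y 0 f * k0 - c.Y 1 f * k1

theorem euler_D (f : R) : c.euler (c.D f) = c.D (c.euler f) := by
  have k0 := c.euler_J 0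
  have k1 := c.euler_J 1
  simp only [c.D_apply f, map_add, Derivation.leibniz, smul_eq_mul, k0, k1]
  simp only [euler_apply, D_apply, c.Y_Y 1 0, Derivation.leibniz, smul_eq_mul, map_add, c.Y_y]
  simp
  ring

theorem Y_euler (i : Fin 2) (f : R) : c.Y i (c.euler f) = c.euler (c.Y i f) + c.Y i f := by
  fin_cases i <;> simp [euler_apply, c.Y_y, c.Y_Y 1 0] <;> ring

theorem X_euler (i : Fin 2) (f : R) : c.X i (c.euler f) = c.euler (c.X i f) := by
  simp [euler_apply, c.X_y, c.X_Y]

theorem euler_y (i : Fin 2) : c.euler (c.y i) = c.y i := by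
  fin_cases i <;> simp [euler_apply, c.Y_y]

theorem euler_N (i : Fin 2) : c.euler (c.N i) = 2 * c.N i := by
  have h3 := c.g_symm
  fin_cases i <;>
  simp [euler_apply, N, c.Y_detInv, c.Y_g, Y_sprayLow] <;>
  simp only [sprayLow_eq, X_low, h3] <;> ring

theorem euler_L : c.euler c.L = 2 * c.L := by
  rw [euler_apply, c.Y_L, c.Y_L, c.L_eq, c.g_symm]
  ring

theorem euler_T (f : R) : c.euler (c.T f) = c.T (c.euler f) + c.T f := by
  simp only [c.T_apply f, map_add, map_sub, Derivation.leibniz, smul_eq_mul, euler_y, euler_N,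
    derivation_two]
  simp only [T_apply, c.X_euler, c.Y_euler]
  ring

/-- `F` is constant along its geodesics. -/
theorem T_L : c.T c.L = 0 := by
  have h : c.T (c.euler c.L) = c.y 0 * c.T (c.Y 0 c.L) + c.y 1 * c.T (c.Y 1 c.L)
      + c.T (c.y 0) * c.Y 0 c.L + c.T (c.y 1) * c.Y 1 c.L := by
    rw [euler_apply]; simp only [map_add, Derivation.leibniz, smul_eq_mul]; ring
  rw [T_Y_L, T_Y_L, euler_L, Derivation.leibniz, derivation_two] at h
  have h0 : c.T (c.y 0) = - c.N 0 := by simp [T_apply, c.X_y, c.Y_y]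
  have h1 : c.T (c.y 1) = - c.N 1 := by simp [T_apply, c.X_y, c.Y_y]
  rw [h0, h1] at h
  simp only [smul_eq_mul] at h
  linear_combination h - T_apply c c.L

/-- `F` is constant along parallel displacements. -/
theorem H_L : c.H c.L = 0 := by
  have h := c.D_T c.L
  rw [T_L, D_L, map_zero, map_zero, zero_add] at h
  exact h.symm

theorem euler_H (f : R) : c.euler (c.H f) = c.H (c.euler f) + c.H f := by
  have h (f : R) : c.H f = c.D (c.T f) - c.T (c.D f) := by rw [D_T]; ring
  simp only [h, map_sub, map_add, euler_D, euler_T]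
  ring

end RiemannianCalculus
end ConicFinsler

/-! ### The spray and the Douglas tensor after a conformal change -/

namespace ConicFinsler

variable {R : Type*} [CommRing R] [Algebra ℝ R]
namespace RiemannianCalculus

variable (c : RiemannianCalculus R)

/-- The area spanned by `y` and `J y`. -/
theorem area_eq : c.y 0 * c.J 1 - c.y 1 * c.J 0 = c.w * c.L := by
  rw [c.L_eq]
  simp [J, low, c.g_symm]
  ring

theorem area_mul : (c.y 0 * c.J 1 - c.y 1 * c.J 0) *
    (c.w * c.ε * (c.g 0 0 * c.g 1 1 - c.g 0 1 ^ 2) * c.LInv) = 1 := by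
  rw [area_eq]
  linear_combination c.L * c.LInv * c.w_sq_mul + c.L_mul

/-- A covector vanishes if its values on `y` and `J y` do. -/
theorem eq_zero_of_contractions {t : Fin 2 → R} (hy : c.y 0 * t 0 + c.y 1 * t 1 = 0)
    (hJ : c.J 0 * t 0 + c.J 1 * t 1 = 0) (i : Fin 2) : t i = 0 := by
  have h := c.area_mul
  generalize c.w * c.ε * (c.g 0 0 * c.g 1 1 - c.g 0 1 ^ 2) * c.LInv = a at h
  fin_cases i
  · simp only [Fin.zero_eta]
    linear_combination a * (c.J 1 * hy - c.y 1 * hJ) - t 0 * h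
  · simp only [Fin.mk_one]
    linear_combination a * (c.y 0 * hJ - c.J 0 * hy) - t 1 * h

theorem derivation_euler (d : Derivation ℝ R R) (f : R) : d (c.euler f) =
    c.y 0 * d (c.Y 0 f) + c.y 1 * d (c.Y 1 f) + d (c.y 0) * c.Y 0 f + d (c.y 1) * c.Y 1 f := by
  rw [euler_apply]; simp only [map_add, Derivation.leibniz, smul_eq_mul]; ring

theorem derivation_D (d : Derivation ℝ R R) (f : R) : d (c.D f) =
    c.J 0 * d (c.Y 0 f) + c.J 1 * d (c.Y 1 f) + d (c.J 0) * c.Y 0 f + d (c.J 1) * c.Y 1 f := by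
  rw [D_apply]; simp only [map_add, Derivation.leibniz, smul_eq_mul]; ring

theorem hessian_J_J (f : R) :
    c.J 0 * (c.J 0 * c.Y 0 (c.Y 0 f) + c.J 1 * c.Y 1 (c.Y 0 f)) +
      c.J 1 * (c.J 0 * c.Y 0 (c.Y 1 f) + c.J 1 * c.Y 1 (c.Y 1 f)) =
    c.D (c.D f) + c.ε * c.euler f := by
  rw [c.derivation_D c.D f, D_J, D_J, euler_apply, D_apply, D_apply]
  ring

theorem third_contract_y {f : R} (hf : c.euler f = 2 * f) (j k : Fin 2) :
    c.y 0 * c.Y 0 (c.Y j (c.Y k f)) + c.y 1 * c.Y 1 (c.Y j (c.Y k f)) = 0 := by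
  have h : c.euler (c.Y k f) = c.Y k f := by
    have := c.Y_euler k f
    rw [hf, Derivation.leibniz, derivation_two] at this
    simp only [smul_eq_mul] at this
    linear_combination -this
  have h2 := c.Y_euler j (c.Y k f)
  rw [h] at h2
  rw [← euler_apply]
  linear_combination -h2

/-- The third fibre derivative of a function of degree two, evaluated three times on `J y`. -/
theorem third_contract_J {f : R} (hf : c.euler f = 2 * f) :
    (c.J 0 * (c.J 0 * (c.J 0 * c.Y 0 (c.Y 0 (c.Y 0 f)) + c.J 1 * c.Y 1 (c.Y 0 (c.Y 0 f))) +
       c.J 1 * (c.J 0 * c.Y 0 (c.Y 1 (c.Y 0 f)) + c.J 1 * c.Y 1 (c.Y 1 (c.Y 0 f)))) +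
     c.J 1 * (c.J 0 * (c.J 0 * c.Y 0 (c.Y 0 (c.Y 1 f)) + c.J 1 * c.Y 1 (c.Y 0 (c.Y 1 f))) +
       c.J 1 * (c.J 0 * c.Y 0 (c.Y 1 (c.Y 1 f)) + c.J 1 * c.Y 1 (c.Y 1 (c.Y 1 f))))) =
    c.D (c.D (c.D f)) + 4 * c.ε * c.D f := by
  have h : ∀ k, c.euler (c.Y k f) = c.Y k f := fun k => by
    have := c.Y_euler k f
    rw [hf, Derivation.leibniz, derivation_two] at this
    simp only [smul_eq_mul] at this
    linear_combination -this
  rw [hessian_J_J, hessian_J_J, h, h]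
  have h1 := c.derivation_D c.D f
  have h2 := congrArg c.D h1
  simp only [map_add, Derivation.leibniz, D_J, map_neg, derivation_ε, D_y, smul_eq_mul] at h2
  have h3 := c.D_apply f
  have h4 := congrArg c.D hf
  rw [derivation_euler, D_y, D_y, Derivation.leibniz, derivation_two] at h4
  simp only [smul_eq_mul] at h4
  linear_combination -h2 + 2 * c.ε * h4

/-- A covector annihilating `y` is a multiple of `(-y^1, y^0)`, determined by its value on `J y`. -/
theorem area_mul_of_contract_y {t : Fin 2 → R} (hy : c.y 0 * t 0 + c.y 1 * t 1 = 0) (i : Fin 2) :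
    (c.y 0 * c.J 1 - c.y 1 * c.J 0) * t i =
      ![-c.y 1, c.y 0] i * (c.J 0 * t 0 + c.J 1 * t 1) := by
  fin_cases i
  · simp
    linear_combination c.J 1 * hy
  · simp
    linear_combination -c.J 0 * hy

/-- The third fibre derivatives of a function `f` of degree two are annihilated by `y`, hence are
all determined by the single function `D³ f + 4 ε D f`. -/
theorem third_eq {f : R} (hf : c.euler f = 2 * f) (j k l : Fin 2) :
    (c.y 0 * c.J 1 - c.y 1 * c.J 0) ^ 3 * c.Y j (c.Y k (c.Y l f)) =
    ![-c.y 1, c.y 0] j * ![-c.y 1, c.y 0] k * ![-c.y 1, c.y 0] l *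
      (c.D (c.D (c.D f)) + 4 * c.ε * c.D f) := by
  rw [← c.third_contract_J hf]
  have h := c.third_contract_y hf
  have e1 (k l : Fin 2) := c.area_mul_of_contract_y (t := fun j => c.Y j (c.Y k (c.Y l f)))
    (h k l) j
  have e2 (l : Fin 2) := c.area_mul_of_contract_y
    (t := fun k => c.J 0 * c.Y 0 (c.Y k (c.Y l f)) + c.J 1 * c.Y 1 (c.Y k (c.Y l f))) (by
      have h0 := h 0 l
      have h1 := h 1 l
      simp only [c.Y_Y 1 0 (c.Y l f)] at h0 h1 ⊢
      linear_combination c.J 0 * h0 + c.J 1 * h1) k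
  have e3 := c.area_mul_of_contract_y
    (t := fun l => c.J 0 * (c.J 0 * c.Y 0 (c.Y 0 (c.Y l f)) + c.J 1 * c.Y 1 (c.Y 0 (c.Y l f))) +
       c.J 1 * (c.J 0 * c.Y 0 (c.Y 1 (c.Y l f)) + c.J 1 * c.Y 1 (c.Y 1 (c.Y l f)))) (by
      have h0 := h 0 0
      have h1 := h 0 1
      have h2 := h 1 1
      simp only [c.Y_Y 1 0 f, c.Y_Y 1 0 (c.Y _ f)] at h0 h1 h2 ⊢
      linear_combination c.J 0 ^ 2 * h0 + 2 * c.J 0 * c.J 1 * h1 + c.J 1 ^ 2 * h2) l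
  generalize c.y 0 * c.J 1 - c.y 1 * c.J 0 = δ at e1 e2 e3 ⊢
  generalize ![-c.y 1, c.y 0] = n at e1 e2 e3 ⊢
  linear_combination δ ^ 2 * e1 k l + n j * δ * e2 l + n j * n k * e3

end RiemannianCalculus

/-- The change `F ↦ e^φ F` in algebraic form: `φ` is homogeneous of degree `0`, `v` stands for
`e^{2φ}`, and `ρ` is the inverse of `φ_{;2;2} + (φ_{;2})² + ε`. -/
structure ConformalCalculus (R : Type*) [CommRing R] [Algebra ℝ R] extends
    RiemannianCalculus R where
  /-- the conformal factor -/
  φ : R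
  /-- `e^{2φ}` -/
  v : R
  /-- the inverse of `φ_{;2;2} + (φ_{;2})² + ε` -/
  ρ : R
  euler_φ : toRiemannianCalculus.euler φ = 0
  X_v : ∀ i, X i v = 2 * v * X i φ
  Y_v : ∀ i, Y i v = 2 * v * Y i φ
  ρ_mul : (toRiemannianCalculus.D (toRiemannianCalculus.D φ) + toRiemannianCalculus.D φ ^ 2 + ε)
    * ρ = 1

namespace ConformalCalculus

variable (c : ConformalCalculus R)

/-- Four times the component along `J y` of the change of the spray coefficients; it equals
`4 ε Q / F`. -/
def β : R := c.ρ * (c.D c.φ * c.T c.φ + c.T (c.D c.φ) - c.H c.φ)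

/-- Four times the component along `y` of the change of the spray coefficients. -/
def α : R := c.T c.φ - c.β * c.D c.φ

/-- Four times the spray coefficients of `e^φ F`, by `spray_equation`. -/
def N' (i : Fin 2) : R := c.N i + c.α * c.y i + c.β * c.J i

theorem D_v : c.D c.v = 2 * c.v * c.D c.φ := by
  simp only [RiemannianCalculus.D_apply, c.Y_v]; ring

theorem T_v : c.T c.v = 2 * c.v * c.T c.φ := by
  simp only [RiemannianCalculus.T_apply, c.Y_v, c.X_v]; ring

theorem H_v : c.H c.v = 2 * c.v * c.H c.φ := by
  simp only [RiemannianCalculus.H_apply, c.Y_v, c.X_v]; ring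

theorem euler_v : c.euler c.v = 0 := by
  have h := c.euler_φ
  simp only [RiemannianCalculus.euler_apply, c.Y_v] at h ⊢
  linear_combination 2 * c.v * h

theorem euler_vL : c.euler (c.v * c.L) = 2 * (c.v * c.L) := by
  simp only [Derivation.leibniz, smul_eq_mul, euler_v, c.euler_L]; ring

theorem D_vL : c.D (c.v * c.L) = c.L * (2 * c.v * c.D c.φ) := by
  simp only [Derivation.leibniz, smul_eq_mul, D_v, c.D_L]; ring

theorem T_vL : c.T (c.v * c.L) = c.L * (2 * c.v * c.T c.φ) := by
  simp only [Derivation.leibniz, smul_eq_mul, T_v, c.T_L]; ring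

theorem H_vL : c.H (c.v * c.L) = c.L * (2 * c.v * c.H c.φ) := by
  simp only [Derivation.leibniz, smul_eq_mul, H_v, c.H_L]; ring

theorem D_D_vL : c.D (c.D (c.v * c.L)) =
    c.L * (2 * c.v * (c.D (c.D c.φ) + 2 * c.D c.φ ^ 2)) := by
  rw [D_vL]
  simp only [Derivation.leibniz, smul_eq_mul, c.D_L, D_v, derivation_two]; ring

theorem T_D_vL : c.T (c.D (c.v * c.L)) =
    c.L * (2 * c.v * (c.T (c.D c.φ) + 2 * c.D c.φ * c.T c.φ)) := by
  rw [D_vL]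
  simp only [Derivation.leibniz, smul_eq_mul, c.T_L, T_v, derivation_two]; ring

theorem Y_Y_vL_contract_y (j : Fin 2) :
    c.y 0 * c.Y 0 (c.Y j (c.v * c.L)) + c.y 1 * c.Y 1 (c.Y j (c.v * c.L))
      = c.Y j (c.v * c.L) := by
  have h := c.Y_euler j (c.v * c.L)
  rw [euler_vL, RiemannianCalculus.euler_apply, Derivation.leibniz, derivation_two] at h
  simp only [smul_eq_mul] at h
  linear_combination -h

theorem T_y (i : Fin 2) : c.T (c.y i) = -c.N i := by
  fin_cases i <;> simp [RiemannianCalculus.T_apply, c.X_y, c.Y_y]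

/-- The Euler-Lagrange equations of `e^{2φ} F²`, which identify `N'` as four times its spray
coefficients. They are tested on the two vectors `y` and `J y`. -/
theorem spray_equation (j : Fin 2) :
    c.N' 0 * c.Y 0 (c.Y j (c.v * c.L)) + c.N' 1 * c.Y 1 (c.Y j (c.v * c.L)) =
    2 * (c.y 0 * c.X 0 (c.Y j (c.v * c.L)) + c.y 1 * c.X 1 (c.Y j (c.v * c.L))
      - c.X j (c.v * c.L)) := by
  rw [← sub_eq_zero]
  have hE : c.Y 0 (c.v * c.L) * c.y 0 + c.Y 1 (c.v * c.L) * c.y 1 = 2 * (c.v * c.L) := by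
    rw [← euler_vL, RiemannianCalculus.euler_apply]; ring
  have hy0 := c.Y_Y_vL_contract_y 0
  have hy1 := c.Y_Y_vL_contract_y 1
  have hD := c.D_vL
  have hT := c.T_vL
  have hH := c.H_vL
  have hTE := c.derivation_euler c.T (c.v * c.L)
  rw [euler_vL, Derivation.leibniz, derivation_two, T_y, T_y] at hTE
  simp only [smul_eq_mul] at hTE
  have hTD := c.derivation_D c.T (c.v * c.L)
  rw [T_D_vL] at hTD
  have hJJ := c.hessian_J_J (c.v * c.L)
  rw [D_D_vL, euler_vL] at hJJ
  rw [RiemannianCalculus.H_apply] at hH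
  have hβ : c.β * (c.D (c.D c.φ) + c.D c.φ ^ 2 + c.ε) =
      c.D c.φ * c.T c.φ + c.T (c.D c.φ) - c.H c.φ := by
    rw [β]
    linear_combination (c.D c.φ * c.T c.φ + c.T (c.D c.φ) - c.H c.φ) * c.ρ_mul
  have hα : c.α + c.β * c.D c.φ = c.T c.φ := by rw [α]; ring
  rw [RiemannianCalculus.D_apply] at hD
  have hTY0 := c.T_apply (c.Y 0 (c.v * c.L))
  have hTY1 := c.T_apply (c.Y 1 (c.v * c.L))
  have hT2 := c.T_apply (c.v * c.L)
  refine c.eq_zero_of_contractions (t := fun j =>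
    (c.N' 0 * c.Y 0 (c.Y j (c.v * c.L)) + c.N' 1 * c.Y 1 (c.Y j (c.v * c.L))) -
    2 * (c.y 0 * c.X 0 (c.Y j (c.v * c.L)) + c.y 1 * c.X 1 (c.Y j (c.v * c.L))
      - c.X j (c.v * c.L))) ?_ ?_ j
  -- Along `y` the equation holds by the definition of `α`.
  · simp only [N']
    simp only [c.Y_Y 1 0 (c.v * c.L)] at hy0 hTY0 ⊢
    linear_combination c.y 0 * hTY0 + c.y 1 * hTY1 + (c.α * c.y 0 + c.β * c.J 0) * hy0
      + (c.α * c.y 1 + c.β * c.J 1) * hy1 + hTE - hT2 + c.α * hE + c.β * hD - hT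
      + 2 * (c.v * c.L) * hα
  -- Along `J y` the equation holds by the definition of `β`.
  · simp only [N']
    simp only [c.Y_Y 1 0 (c.v * c.L)] at hy0 hJJ hTY0 ⊢
    linear_combination c.J 0 * hTY0 + c.J 1 * hTY1 + c.α * (c.J 0 * hy0 + c.J 1 * hy1)
      + c.β * hJJ + hTD + hH + c.α * hD + 2 * (c.v * c.L) * (c.D c.φ * hα + hβ)

/-- The discriminant of the change governs the non-degeneracy of `e^φ F`. -/
theorem det_hessian_vL :
    (c.Y 0 (c.Y 0 (c.v * c.L)) * c.Y 1 (c.Y 1 (c.v * c.L)) - c.Y 0 (c.Y 1 (c.v * c.L)) ^ 2) *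
      (c.y 0 * c.J 1 - c.y 1 * c.J 0) ^ 2 =
    4 * (c.v * c.L) ^ 2 * (c.D (c.D c.φ) + c.D c.φ ^ 2 + c.ε) := by
  have hE : c.Y 0 (c.v * c.L) * c.y 0 + c.Y 1 (c.v * c.L) * c.y 1 = 2 * (c.v * c.L) := by
    rw [← euler_vL, RiemannianCalculus.euler_apply]; ring
  have hy0 := c.Y_Y_vL_contract_y 0
  have hy1 := c.Y_Y_vL_contract_y 1
  have hD := c.D_vL
  have hJJ := c.hessian_J_J (c.v * c.L)
  rw [D_D_vL, euler_vL] at hJJ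
  rw [RiemannianCalculus.D_apply] at hD
  simp only [c.Y_Y 1 0 (c.v * c.L)] at hy0 hJJ
  generalize c.Y 0 (c.Y 0 (c.v * c.L)) = a at *
  generalize c.Y 0 (c.Y 1 (c.v * c.L)) = b at *
  generalize c.Y 1 (c.Y 1 (c.v * c.L)) = d at *
  -- The Hessian in the frame `(y, J)`.
  have h1 : c.y 0 * (a * c.y 0 + b * c.y 1) + c.y 1 * (b * c.y 0 + d * c.y 1) =
      2 * (c.v * c.L) := by
    linear_combination hE + c.y 0 * hy0 + c.y 1 * hy1
  have h2 : c.J 0 * (a * c.y 0 + b * c.y 1) + c.J 1 * (b * c.y 0 + d * c.y 1) =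
      c.L * (2 * c.v * c.D c.φ) := by
    linear_combination hD + c.J 0 * hy0 + c.J 1 * hy1
  have h3 : (a * d - b ^ 2) * (c.y 0 * c.J 1 - c.y 1 * c.J 0) ^ 2 =
      (c.y 0 * (a * c.y 0 + b * c.y 1) + c.y 1 * (b * c.y 0 + d * c.y 1)) *
        (c.J 0 * (c.J 0 * a + c.J 1 * b) + c.J 1 * (c.J 0 * b + c.J 1 * d)) -
      (c.J 0 * (a * c.y 0 + b * c.y 1) + c.J 1 * (b * c.y 0 + d * c.y 1)) ^ 2 := by ring
  rw [h3, h1, h2, hJJ]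
  ring

theorem euler_ρ : c.euler c.ρ = 0 := by
  have h := congrArg c.euler c.ρ_mul
  simp only [Derivation.leibniz, map_add, Derivation.leibniz_pow, c.derivation_ε,
    c.euler_D, Derivation.map_one_eq_zero, euler_φ, map_zero, smul_zero, add_zero, smul_eq_mul,
    mul_zero] at h
  linear_combination c.ρ * h - c.euler c.ρ * c.ρ_mul

theorem euler_β : c.euler c.β = c.β := by
  simp only [β, Derivation.leibniz, map_add, map_sub, c.euler_H, c.euler_D, c.euler_T,
    euler_φ, euler_ρ, map_zero, smul_eq_mul]
  ring

theorem euler_α : c.euler c.α = c.α := by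
  simp only [α, Derivation.leibniz, map_sub, c.euler_D, c.euler_T,
    euler_φ, euler_β, map_zero, smul_eq_mul]
  ring

/-- Twelve times the part of `G^i - (1/3) (∂̇_r G^r) y^i`, for the metric `e^φ F`, that comes from
the change. Only the component `β` of the change survives. -/
def P (i : Fin 2) : R := 3 * c.β * c.J i - c.D c.β * c.y i

theorem euler_P (i : Fin 2) : c.euler (c.P i) = 2 * c.P i := by
  simp only [P, Derivation.leibniz, map_sub, c.euler_D, c.euler_J, c.euler_y, euler_β,
    smul_eq_mul]
  rw [show c.euler 3 = 0 by exact_mod_cast c.euler.map_natCast 3]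
  ring

/-- The function governing the third fibre derivatives of `P i`, by `third_eq`. -/
theorem D_D_D_P (i : Fin 2) : c.D (c.D (c.D (c.P i))) + 4 * c.ε * c.D (c.P i) =
    -(9 * c.β + 10 * c.ε * c.D (c.D c.β) + c.D (c.D (c.D (c.D c.β)))) * c.y i := by
  have h3 : c.D 3 = 0 := by exact_mod_cast c.D.map_natCast 3
  have e1 : c.D (c.P i) = 2 * c.D c.β * c.J i - (3 * c.ε * c.β + c.D (c.D c.β)) * c.y i := by
    simp only [P, Derivation.leibniz, map_sub, c.D_J, c.D_y, smul_eq_mul, h3]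
    ring
  have e2 : c.D (c.D (c.P i)) = (c.D (c.D c.β) - 3 * c.ε * c.β) * c.J i -
      (5 * c.ε * c.D c.β + c.D (c.D (c.D c.β))) * c.y i := by
    rw [e1]
    simp only [Derivation.leibniz, map_sub, map_add, c.D_J, c.D_y, smul_eq_mul, h3,
      derivation_two, c.derivation_ε]
    ring
  have e3 : c.D (c.D (c.D (c.P i))) = -8 * c.ε * c.D c.β * c.J i +
      (3 * c.ε ^ 2 * c.β - 6 * c.ε * c.D (c.D c.β) - c.D (c.D (c.D (c.D c.β)))) * c.y i := by
    rw [e2]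
    have h5 : c.D 5 = 0 := by exact_mod_cast c.D.map_natCast 5
    simp only [Derivation.leibniz, map_sub, map_add, c.D_J, c.D_y, smul_eq_mul, h3, h5,
      c.derivation_ε]
    ring
  rw [e3, e1]
  linear_combination (-9 * c.β * c.y i) * c.ε_sq

/-- The contributions of `N` are quadratic in `y`, and those of `α` cancel because `α` is
homogeneous of degree one. -/
theorem Y_Y_Y_projective (i j k l : Fin 2) :
    c.Y j (c.Y k (c.Y l (3 * c.N' i - (c.Y 0 (c.N' 0) + c.Y 1 (c.N' 1)) * c.y i))) =
    c.Y j (c.Y k (c.Y l (c.P i))) := by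
  have hdiv : c.Y 0 (c.N' 0) + c.Y 1 (c.N' 1) =
      c.Y 0 (c.N 0) + c.Y 1 (c.N 1) + 3 * c.α + c.D c.β := by
    have h0 : c.Y 0 (c.J 0) + c.Y 1 (c.J 1) = 0 := by
      simp [RiemannianCalculus.J, c.Y_low, c.Y_w, c.g_symm]
    have h1 := c.euler_α
    rw [RiemannianCalculus.euler_apply] at h1
    have h2 := c.D_apply c.β
    simp only [N', map_add, Derivation.leibniz, smul_eq_mul, c.Y_y]
    simp
    linear_combination h1 - h2 + c.β * h0
  have e : 3 * c.N' i - (c.Y 0 (c.N' 0) + c.Y 1 (c.N' 1)) * c.y i =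
      3 * c.N i - (c.Y 0 (c.N 0) + c.Y 1 (c.N 1)) * c.y i + c.P i := by
    rw [hdiv, N', P]; ring
  have hyy (a b : Fin 2) (d : Derivation ℝ R R) : d (c.Y a (c.y b)) = 0 := by
    rw [c.Y_y]; split_ifs <;> simp
  have h3 (d : Derivation ℝ R R) : d 3 = 0 := by exact_mod_cast d.map_natCast 3
  rw [e, map_add, map_add, map_add]
  simp only [Derivation.leibniz, map_add, map_sub, hyy, h3, c.Y_Y_Y_N, smul_eq_mul, mul_zero,
    add_zero, zero_add, sub_zero]

/-- The Douglas tensor of `e^φ F`, up to a unit, as a multiple of `9 β + 10 ε D² β + D⁴ β`. -/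
theorem third_P (i j k l : Fin 2) :
    (c.y 0 * c.J 1 - c.y 1 * c.J 0) ^ 3 *
      c.Y j (c.Y k (c.Y l (3 * c.N' i - (c.Y 0 (c.N' 0) + c.Y 1 (c.N' 1)) * c.y i))) =
    -(![-c.y 1, c.y 0] j * ![-c.y 1, c.y 0] k * ![-c.y 1, c.y 0] l * c.y i *
      (9 * c.β + 10 * c.ε * c.D (c.D c.β) + c.D (c.D (c.D (c.D c.β))))) := by
  rw [Y_Y_Y_projective, c.third_eq (c.euler_P i), D_D_D_P]
  ring

end ConformalCalculus

end ConicFinsler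

/-! ### The algebra of smooth functions on an open set -/

namespace ConicFinsler

open TopologicalSpace (Opens)

section SmoothFun

variable {E : Type*} [NormedAddCommGroup E] [NormedSpace ℝ E]

/-- The algebra of smooth functions on the open set `U`. Its elements are functions on the subtype
`U`, so that a function vanishing nowhere on `U` is a unit; smoothness is that of some extension. -/
def SmoothFun (U : Opens E) : Subalgebra ℝ (U → ℝ) where
  carrier := {f | ∃ g : E → ℝ, ContDiffOn ℝ ∞ g U ∧ ∀ p : U, g p = f p}
  mul_mem' := by
    rintro _ _ ⟨g, hg, h⟩ ⟨g', hg', h'⟩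
    exact ⟨fun p => g p * g' p, hg.mul hg', fun p => by simp [h, h']⟩
  add_mem' := by
    rintro _ _ ⟨g, hg, h⟩ ⟨g', hg', h'⟩
    exact ⟨fun p => g p + g' p, hg.add hg', fun p => by simp [h, h']⟩
  algebraMap_mem' r := ⟨fun _ => r, contDiffOn_const, fun _ => rfl⟩

variable {U : Opens E}

/-- The function `g` on `E` restricts to `f` on `U`. -/
def Represents (g : E → ℝ) (f : SmoothFun U) : Prop := ∀ p : U, g p = f.1 p

/-- A chosen function on `E` restricting to `f` on `U`. -/
def SmoothFun.toFun (f : SmoothFun U) : E → ℝ := f.2.choose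

theorem SmoothFun.represents_toFun (f : SmoothFun U) : Represents (SmoothFun.toFun f) f :=
  f.2.choose_spec.2

theorem Represents.eventuallyEq {g g' : E → ℝ} {f : SmoothFun U} (h : Represents g f)
    (h' : Represents g' f) (p : U) : g =ᶠ[nhds (p : E)] g' := by
  filter_upwards [U.isOpen.mem_nhds p.2] with q hq
  exact (h ⟨q, hq⟩).trans (h' ⟨q, hq⟩).symm

theorem Represents.contDiffOn {g : E → ℝ} {f : SmoothFun U} (h : Represents g f) :
    ContDiffOn ℝ ∞ g U := by
  obtain ⟨g', hg', h'⟩ := f.2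
  exact hg'.congr fun p hp => (h ⟨p, hp⟩).trans (h' ⟨p, hp⟩).symm

theorem Represents.contDiffAt {g : E → ℝ} {f : SmoothFun U} (h : Represents g f) (p : U) :
    ContDiffAt ℝ ∞ g p :=
  h.contDiffOn.contDiffAt (U.isOpen.mem_nhds p.2)

theorem Represents.differentiableAt {g : E → ℝ} {f : SmoothFun U} (h : Represents g f) (p : U) :
    DifferentiableAt ℝ g p :=
  (h.contDiffAt p).differentiableAt (by simp)

/-- The restriction to `U` of a function smooth on `U`. -/
def SmoothFun.of (g : E → ℝ) (hg : ContDiffOn ℝ ∞ g U) : SmoothFun U :=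
  ⟨fun p => g p, g, hg, fun _ => rfl⟩

theorem SmoothFun.represents_of (g : E → ℝ) (hg : ContDiffOn ℝ ∞ g U) :
    Represents g (SmoothFun.of g hg) := fun _ => rfl

theorem contDiffOn_fderiv_apply {g : E → ℝ} (hg : ContDiffOn ℝ ∞ g U) (v : E) :
    ContDiffOn ℝ ∞ (fun p => fderiv ℝ g p v) U :=
  (hg.fderiv_of_isOpen U.isOpen (m := ∞) (by simp)).clm_apply contDiffOn_const

/-- The derivative in the constant direction `v`, as a derivation. -/
def dirDeriv (v : E) : Derivation ℝ (SmoothFun U) (SmoothFun U) :=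
  Derivation.mk'
    { toFun := fun f => SmoothFun.of (fun p => fderiv ℝ (SmoothFun.toFun f) p v)
        (contDiffOn_fderiv_apply (SmoothFun.represents_toFun f).contDiffOn v)
      map_add' := fun a b => by
        have ha := SmoothFun.represents_toFun a
        have hb := SmoothFun.represents_toFun b
        have hab := SmoothFun.represents_toFun (a + b)
        ext p
        have : Represents (fun q => SmoothFun.toFun a q + SmoothFun.toFun b q)
          (a + b) := fun q => by simp [ha q, hb q]
        simp only [SmoothFun.of]
        rw [(hab.eventuallyEq this p).fderiv_eq,
          fderiv_fun_add (ha.differentiableAt p) (hb.differentiableAt p)]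
        rfl
      map_smul' := fun r a => by
        have ha := SmoothFun.represents_toFun a
        have hra := SmoothFun.represents_toFun (r • a)
        ext p
        have : Represents (fun q => r • SmoothFun.toFun a q)
          (r • a) := fun q => by simp [ha q]
        simp only [SmoothFun.of]
        rw [(hra.eventuallyEq this p).fderiv_eq, fderiv_fun_const_smul (ha.differentiableAt p)]
        rfl }
    fun a b => by
      have ha := SmoothFun.represents_toFun a
      have hb := SmoothFun.represents_toFun b
      have hab := SmoothFun.represents_toFun (a * b)
      ext p
      have : Represents (fun q => SmoothFun.toFun a q * SmoothFun.toFun b q)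
        (a * b) := fun q => by simp [ha q, hb q]
      simp only [SmoothFun.of, LinearMap.coe_mk, AddHom.coe_mk]
      rw [(hab.eventuallyEq this p).fderiv_eq,
        fderiv_fun_mul (ha.differentiableAt p) (hb.differentiableAt p), ha p, hb p]
      rfl

/-- The derivative on `U` does not depend on the chosen extension, since `U` is open. -/
theorem Represents.deriv {g : E → ℝ} {f : SmoothFun U} (h : Represents g f) (v : E) :
    Represents (fun p => fderiv ℝ g p v) (dirDeriv v f) := fun p => by
  change fderiv ℝ g p v = fderiv ℝ (SmoothFun.toFun f) p v
  rw [(h.eventuallyEq (SmoothFun.represents_toFun f) p).fderiv_eq]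

theorem dirDeriv_comm (v w : E) (f : SmoothFun U) :
    dirDeriv v (dirDeriv w f) = dirDeriv w (dirDeriv v f) := by
  have h := SmoothFun.represents_toFun f
  set g := SmoothFun.toFun f
  ext p
  rw [← ((h.deriv w).deriv v) p, ← ((h.deriv v).deriv w) p]
  have hs : IsSymmSndFDerivAt ℝ g p :=
    (h.contDiffAt p).isSymmSndFDerivAt (by simp; exact WithTop.coe_le_coe.2 le_top)
  have hd : DifferentiableAt ℝ (fderiv ℝ g) p :=
    ((h.contDiffAt p).fderiv_right (m := ∞) (by simp)).differentiableAt (by simp)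
  have e (v w : E) : fderiv ℝ (fun q => fderiv ℝ g q v) p w = fderiv ℝ (fderiv ℝ g) p w v := by
    rw [fderiv_clm_apply hd (differentiableAt_const v)]
    simp
  beta_reduce
  rw [e, e]
  exact hs v w

theorem SmoothFun.ext_represents {g : E → ℝ} {a b : SmoothFun U} (ha : Represents g a)
    (hb : Represents g b) : a = b := by
  ext p; rw [← ha p, ← hb p]

/-- Composition of a nowhere vanishing smooth function with a function smooth away from `0`. -/
def SmoothFun.comp (f : SmoothFun U) (hf : ∀ p, f.1 p ≠ 0) (h : ℝ → ℝ)
    (hh : ContDiffOn ℝ ∞ h {0}ᶜ) : SmoothFun U :=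
  ⟨fun p => h (f.1 p), by
    obtain ⟨g, hg, hr⟩ := f.2
    refine ⟨fun p => h (g p), hh.comp hg fun p hp => ?_, fun p => by beta_reduce; rw [hr p]⟩
    have := hf ⟨p, hp⟩
    rwa [← hr ⟨p, hp⟩] at this⟩

end SmoothFun

theorem contDiffOn_inv_compl : ContDiffOn ℝ ∞ (fun x : ℝ => x⁻¹) {0}ᶜ := fun _ hx =>
  (contDiffAt_inv ℝ hx).contDiffWithinAt

theorem sign_mul_self_eq_abs (x : ℝ) : Real.sign x * x = |x| := by
  rcases lt_trichotomy x 0 with h | h | h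
  · rw [Real.sign_of_neg h, abs_of_neg h]; ring
  · simp [h]
  · rw [Real.sign_of_pos h, abs_of_pos h]; ring

theorem sign_sq {x : ℝ} (hx : x ≠ 0) : Real.sign x ^ 2 = 1 := by
  rcases lt_or_gt_of_ne hx with h | h
  · rw [Real.sign_of_neg h]; norm_num
  · rw [Real.sign_of_pos h]; norm_num

theorem contDiffOn_sign : ContDiffOn ℝ ∞ Real.sign {0}ᶜ := by
  have : ContDiffOn ℝ ∞ (fun x : ℝ => |x| * x⁻¹) {0}ᶜ := fun x hx =>
    ((contDiffAt_abs hx).mul (contDiffAt_inv ℝ hx)).contDiffWithinAt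
  refine this.congr fun x hx => ?_
  rw [← sign_mul_self_eq_abs, mul_assoc, mul_inv_cancel₀ hx, mul_one]

theorem contDiffOn_inv_sqrt_abs : ContDiffOn ℝ ∞ (fun x : ℝ => (√|x|)⁻¹) {0}ᶜ := fun _ hx =>
  (((contDiffAt_abs hx).sqrt (abs_ne_zero.2 hx)).inv
    (Real.sqrt_ne_zero'.2 (abs_pos.2 hx))).contDiffWithinAt

end ConicFinsler

/-! ### The calculus attached to a metric in coordinates -/

namespace ConicFinsler

open TopologicalSpace (Opens)

variable {U : Opens (Plane × Plane)}

theorem fderiv_snd_apply (j : Fin 2) (p v : Plane × Plane) :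
    fderiv ℝ (fun p : Plane × Plane => p.2 j) p v = v.2 j :=
  congrArg (fun l : Plane × Plane →L[ℝ] ℝ => l v) (((EuclideanSpace.proj j : Plane →L[ℝ] ℝ).comp
    (ContinuousLinearMap.snd ℝ Plane Plane)).hasFDerivAt (x := p)).fderiv

/-- The calculus of smooth functions of `(x, y) ∈ U`. -/
def coordCalculus (U : Opens (Plane × Plane)) : TangentCalculus (SmoothFun U) where
  X i := dirDeriv (EuclideanSpace.single i 1, 0)
  Y i := dirDeriv (0, EuclideanSpace.single i 1)
  y i := SmoothFun.of (fun p => p.2 i) (by fun_prop)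
  X_Y _ _ f := dirDeriv_comm _ _ f
  Y_Y _ _ f := dirDeriv_comm _ _ f
  X_y i j := by
    ext p
    rw [← (SmoothFun.represents_of (U := U) (fun p : Plane × Plane => p.2 j)
      (by fun_prop)).deriv _ p]
    simp [fderiv_snd_apply]
  Y_y i j := by
    ext p
    rw [← (SmoothFun.represents_of (U := U) (fun p : Plane × Plane => p.2 j)
      (by fun_prop)).deriv _ p]
    beta_reduce
    rw [fderiv_snd_apply]
    split_ifs with h
    · simp [h]
    · simp [Ne.symm h]

theorem Represents.dx {f : Plane × Plane → ℝ} {r : SmoothFun U} (h : Represents f r) (i : Fin 2) :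
    Represents (dx i f) ((coordCalculus U).X i r) := h.deriv _

theorem Represents.dy {f : Plane × Plane → ℝ} {r : SmoothFun U} (h : Represents f r) (i : Fin 2) :
    Represents (dy i f) ((coordCalculus U).Y i r) := h.deriv _

/-- `F` is the expression, on an open set `U` of induced coordinates, of a conic pseudo-Riemannian
metric. -/
structure IsLocalRiemannian (U : Opens (Plane × Plane)) (F : Plane × Plane → ℝ) : Prop where
  smooth : ContDiffOn ℝ ∞ F U
  homogeneous : ∀ p ∈ U, ∀ c : ℝ, 0 < c → F (p.1, c • p.2) = c * F p
  nondegenerate : ∀ p ∈ U, (metric F p).det ≠ 0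
  cartan_eq_zero : ∀ p ∈ U, ∀ i j k, cartan F i j k p = 0

/-- Euler's theorem on homogeneous functions, in the fibre variable. -/
theorem fderiv_snd_of_homogeneous {f : Plane × Plane → ℝ} {p : Plane × Plane} {r : ℕ}
    (hf : DifferentiableAt ℝ f p) (h : ∀ c : ℝ, 0 < c → f (p.1, c • p.2) = c ^ r * f p) :
    p.2 0 * dy 0 f p + p.2 1 * dy 1 f p = r * f p := by
  have h1 : HasDerivAt (fun c : ℝ => f (p.1, c • p.2)) (fderiv ℝ f p (0, p.2)) 1 := by
    have hg : HasDerivAt (fun c : ℝ => (p.1, c • p.2)) (0, p.2) 1 := by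
      simpa using (hasDerivAt_const (1 : ℝ) p.1).prodMk ((hasDerivAt_id (1 : ℝ)).smul_const p.2)
    have hf' : HasFDerivAt f (fderiv ℝ f p) ((fun c : ℝ => (p.1, c • p.2)) 1) := by
      simpa using hf.hasFDerivAt
    exact hf'.comp_hasDerivAt 1 hg
  have h2 : HasDerivAt (fun c : ℝ => f (p.1, c • p.2)) (r * f p) 1 := by
    have : HasDerivAt (fun c : ℝ => c ^ r * f p) (r * f p) 1 := by
      simpa using (hasDerivAt_pow r (1 : ℝ)).mul_const (f p)
    refine this.congr_of_eventuallyEq ?_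
    filter_upwards [lt_mem_nhds (zero_lt_one' ℝ)] with c hc using h c hc
  rw [h2.unique h1]
  have : ((0, p.2) : Plane × Plane) = p.2 0 • (0, EuclideanSpace.single 0 1) +
      p.2 1 • (0, EuclideanSpace.single 1 1) := by
    ext i
    · simp
    · fin_cases i <;> simp
  rw [this, map_add, map_smul, map_smul]
  rfl

variable {F : Plane × Plane → ℝ}

theorem Represents.sq {f : Plane × Plane → ℝ} {a : SmoothFun U} (ha : Represents f a) :
    Represents (fun p => f p ^ 2) (a ^ 2) := fun p => by
  simp [ha p]

/-- The metric tensor of `f`, as smooth functions on `U`. -/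
def metricFun (f : SmoothFun U) (i j : Fin 2) : SmoothFun U :=
  (1 / 2 : ℝ) • (coordCalculus U).Y i ((coordCalculus U).Y j (f ^ 2))

theorem two_mul_metricFun (f : SmoothFun U) (i j : Fin 2) : 2 * metricFun f i j =
    (coordCalculus U).Y i ((coordCalculus U).Y j (f ^ 2)) := by
  rw [metricFun, two_mul, ← add_smul]; norm_num

theorem Represents.metric {f : SmoothFun U} (h : Represents F f) (i j : Fin 2) :
    Represents (fun p => metric F p i j) (metricFun f i j) := fun p => by
  have := (h.sq.dy j).dy i p
  simp only [ConicFinsler.metric, Matrix.of_apply, this, metricFun]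
  rfl

theorem metricFun_symm (f : SmoothFun U) (i j : Fin 2) : metricFun f i j = metricFun f j i := by
  rw [metricFun, metricFun, (coordCalculus U).Y_Y]

/-- The determinant of the metric tensor of `f`. -/
def detFun (f : SmoothFun U) : SmoothFun U :=
  metricFun f 0 0 * metricFun f 1 1 - metricFun f 0 1 ^ 2

theorem Represents.det {f : SmoothFun U} (h : Represents F f) :
    Represents (fun p => (ConicFinsler.metric F p).det) (detFun f) := fun p => by
  have e (i j : Fin 2) : ConicFinsler.metric F p i j = (metricFun f i j).1 p := h.metric i j p
  beta_reduce
  rw [Matrix.det_fin_two, e, e, e, e, metricFun_symm f 1 0, ← pow_two]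
  rfl

theorem euler_of_homogeneous {f : Plane × Plane → ℝ} {a : SmoothFun U} (h : Represents f a)
    {r : ℕ} (hr : ∀ p ∈ U, ∀ c : ℝ, 0 < c → f (p.1, c • p.2) = c ^ r * f p) :
    (coordCalculus U).y 0 * (coordCalculus U).Y 0 a +
      (coordCalculus U).y 1 * (coordCalculus U).Y 1 a = r * a := by
  ext p
  have := fderiv_snd_of_homogeneous (h.differentiableAt p) (hr p p.2)
  rw [h.dy 0 p, h.dy 1 p, h p] at this
  exact this

namespace IsLocalRiemannian

/-- At a zero of `F` the metric tensor is `ℓ_i ℓ_j`, which has rank at most one. -/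
theorem ne_zero (hF : IsLocalRiemannian U F) {p : Plane × Plane} (hp : p ∈ U) : F p ≠ 0 := by
  intro h0
  have hf := SmoothFun.represents_of F hF.smooth
  apply hF.nondegenerate p hp
  refine (hf.det ⟨p, hp⟩).trans ?_
  have h0' : (SmoothFun.of F hF.smooth).1 ⟨p, hp⟩ = 0 := h0
  generalize SmoothFun.of F hF.smooth = f at h0'
  have e (i j : Fin 2) : (metricFun f i j).1 ⟨p, hp⟩ =
      ((coordCalculus U).Y i f).1 ⟨p, hp⟩ * ((coordCalculus U).Y j f).1 ⟨p, hp⟩ := by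
    have : metricFun f i j = (coordCalculus U).Y i f * (coordCalculus U).Y j f +
        f * (coordCalculus U).Y i ((coordCalculus U).Y j f) := by
      have h2 := two_mul_metricFun f i j
      simp only [Derivation.leibniz_pow, Derivation.leibniz, smul_eq_mul, nsmul_eq_mul,
        Nat.cast_ofNat, derivation_two, pow_one, Nat.add_one_sub_one] at h2
      rw [← sub_eq_zero]
      apply eq_zero_of_two_mul
      linear_combination h2
    rw [this]
    simp [h0']
  simp only [detFun, AddSubgroupClass.coe_sub, MulMemClass.coe_mul, SubmonoidClass.coe_pow,
    Pi.sub_apply, Pi.mul_apply, Pi.pow_apply, e]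
  ring

theorem detFun_ne_zero (hF : IsLocalRiemannian U F) (p : U) :
    (detFun (SmoothFun.of F hF.smooth)).1 p ≠ 0 := by
  rw [← (SmoothFun.represents_of F hF.smooth).det p]
  exact hF.nondegenerate p p.2

theorem Y_metricFun (hF : IsLocalRiemannian U F) (i j k : Fin 2) :
    (coordCalculus U).Y k (metricFun (SmoothFun.of F hF.smooth) i j) = 0 := by
  ext p
  rw [← ((SmoothFun.represents_of F hF.smooth).metric i j).dy k p]
  have := hF.cartan_eq_zero p p.2 i j k
  rw [cartan] at this
  simpa using this

theorem euler_sq (hF : IsLocalRiemannian U F) :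
    (coordCalculus U).y 0 * (coordCalculus U).Y 0 (SmoothFun.of F hF.smooth ^ 2) +
      (coordCalculus U).y 1 * (coordCalculus U).Y 1 (SmoothFun.of F hF.smooth ^ 2) =
      2 * SmoothFun.of F hF.smooth ^ 2 := by
  have := euler_of_homogeneous (SmoothFun.represents_of F hF.smooth).sq (r := 2)
    fun p hp c hc => by rw [hF.homogeneous p hp c hc, mul_pow]
  exact_mod_cast this

theorem Y_sq (hF : IsLocalRiemannian U F) (i : Fin 2) :
    (coordCalculus U).Y i (SmoothFun.of F hF.smooth ^ 2) =
      2 * (metricFun (SmoothFun.of F hF.smooth) i 0 * (coordCalculus U).y 0 +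
        metricFun (SmoothFun.of F hF.smooth) i 1 * (coordCalculus U).y 1) := by
  have h := congrArg ((coordCalculus U).Y i) hF.euler_sq
  rw [map_add, Derivation.leibniz, Derivation.leibniz, Derivation.leibniz _ 2, derivation_two] at h
  simp only [smul_eq_mul, ← two_mul_metricFun, (coordCalculus U).Y_y] at h
  fin_cases i
  · simp only [Fin.zero_eta, if_true, Fin.isValue, if_false, zero_ne_one] at h ⊢
    linear_combination -h
  · simp only [Fin.mk_one, if_true, Fin.isValue, one_ne_zero, if_false] at h ⊢
    linear_combination -h

/-- The pseudo-Riemannian calculus attached to `F`. -/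
def riemannianCalculus (hF : IsLocalRiemannian U F) : RiemannianCalculus (SmoothFun U) where
  __ := coordCalculus U
  L := SmoothFun.of F hF.smooth ^ 2
  g := metricFun (SmoothFun.of F hF.smooth)
  ε := SmoothFun.comp (detFun (SmoothFun.of F hF.smooth)) hF.detFun_ne_zero _ contDiffOn_sign
  detInv := SmoothFun.comp (detFun (SmoothFun.of F hF.smooth)) hF.detFun_ne_zero _
    contDiffOn_inv_compl
  w := SmoothFun.comp (detFun (SmoothFun.of F hF.smooth)) hF.detFun_ne_zero _
    contDiffOn_inv_sqrt_abs
  LInv := SmoothFun.comp (SmoothFun.of F hF.smooth ^ 2) (fun p => pow_ne_zero 2 (hF.ne_zero p.2)) _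
    contDiffOn_inv_compl
  g_symm := metricFun_symm _ 1 0
  Y_g := hF.Y_metricFun
  Y_L := hF.Y_sq
  L_eq := by
    rw [← sub_eq_zero]
    apply eq_zero_of_two_mul
    have h := hF.euler_sq
    rw [hF.Y_sq, hF.Y_sq, metricFun_symm _ 1 0] at h
    linear_combination -h
  det_mul := by
    ext p
    exact mul_inv_cancel₀ (hF.detFun_ne_zero p)
  ε_sq := by
    ext p
    exact sign_sq (hF.detFun_ne_zero p)
  w_sq := by
    ext p
    have h := hF.detFun_ne_zero p
    change (√|(detFun (SmoothFun.of F hF.smooth)).1 p|)⁻¹ ^ 2 =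
      Real.sign ((detFun (SmoothFun.of F hF.smooth)).1 p) *
        ((detFun (SmoothFun.of F hF.smooth)).1 p)⁻¹
    rw [inv_pow, Real.sq_sqrt (abs_nonneg _), ← sign_mul_self_eq_abs]
    have h2 := sign_sq h
    generalize Real.sign _ = s at h2
    have hs : s ≠ 0 := by rintro rfl; norm_num at h2
    field_simp
    exact h2.symm
  L_mul := by
    ext p
    exact mul_inv_cancel₀ (pow_ne_zero 2 (hF.ne_zero p.2))

end IsLocalRiemannian

end ConicFinsler

/-! ### Scalar derivatives, sprays and the discriminant in coordinates -/

namespace ConicFinsler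

open TopologicalSpace (Opens)

/-- The spray coefficients are the solution of the linear system with matrix `g_ij`. -/
theorem spray_eq_of_metric_mul {F : Plane × Plane → ℝ} {p : Plane × Plane} {N : Fin 2 → ℝ}
    (hdet : (metric F p).det ≠ 0)
    (h : ∀ j, metric F p j 0 * N 0 + metric F p j 1 * N 1 =
      p.2 0 * dx 0 (dy j (fun q => F q ^ 2)) p + p.2 1 * dx 1 (dy j (fun q => F q ^ 2)) p
        - dx j (fun q => F q ^ 2) p) (i : Fin 2) :
    spray F i p = 1 / 4 * N i := by
  have h1 : (metric F p)⁻¹.mulVec ((metric F p).mulVec N) = N := by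
    rw [Matrix.mulVec_mulVec, Matrix.nonsing_inv_mul _ (isUnit_iff_ne_zero.2 hdet),
      Matrix.one_mulVec]
  have h2 := congrFun h1 i
  simp only [Matrix.mulVec, dotProduct, Fin.sum_univ_two] at h2
  rw [h, h] at h2
  simp only [spray, Fin.sum_univ_two]
  rw [h2]

variable {U : Opens (Plane × Plane)} {F : Plane × Plane → ℝ}

/-- The Hessian condition on `φ` in terms of `(j0, j1) = J y` in place of `m`, where
`F m = ε J y`. -/
theorem discriminant_identity {x m0 m1 e j0 j1 y00 y01 y10 y11 z0 z1 : ℝ} (h0 : x * m0 = e * j0)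
    (h1 : x * m1 = e * j1) (he : e ^ 2 = 1) :
    x ^ 2 * ((y00 + z0 * z0) * m0 * m0 + (y01 + z0 * z1) * m0 * m1 +
      ((y10 + z1 * z0) * m1 * m0 + (y11 + z1 * z1) * m1 * m1)) + e =
    j0 * (j0 * y00 + j1 * y10) + j1 * (j0 * y01 + j1 * y11) + (j0 * z0 + j1 * z1) ^ 2 + e := by
  have h00 : x ^ 2 * (m0 * m0) = j0 * j0 := by
    linear_combination (x * m0 + e * j0) * h0 + j0 * j0 * he
  have h01 : x ^ 2 * (m0 * m1) = j0 * j1 := by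
    linear_combination x * m1 * h0 + e * j0 * h1 + j0 * j1 * he
  have h11 : x ^ 2 * (m1 * m1) = j1 * j1 := by
    linear_combination (x * m1 + e * j1) * h1 + j1 * j1 * he
  linear_combination (y00 + z0 * z0) * h00 + (y01 + y10 + 2 * z0 * z1) * h01 +
    (y11 + z1 * z1) * h11

namespace IsLocalRiemannian

variable (hF : IsLocalRiemannian U F)

/-- `F` as an element of the algebra of smooth functions on `U`. -/
def toSmoothFun : SmoothFun U := SmoothFun.of F hF.smooth

theorem represents_self : Represents F hF.toSmoothFun := fun _ => rfl

/-- The inverse of `F` in the algebra of smooth functions on `U`. -/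
def invFun : SmoothFun U := hF.toSmoothFun * hF.riemannianCalculus.LInv

theorem mul_invFun : hF.toSmoothFun * hF.invFun = 1 := by
  have := hF.riemannianCalculus.L_mul
  change hF.toSmoothFun ^ 2 * _ = 1 at this
  rw [invFun, ← this]; ring

theorem invFun_apply (p : U) : hF.invFun.1 p = (F p)⁻¹ := by
  have h := congrArg (fun f : SmoothFun U => f.1 p) hF.mul_invFun
  exact eq_inv_of_mul_eq_one_right h

theorem eps_eq (p : U) : eps F p = hF.riemannianCalculus.ε.1 p :=
  congrArg Real.sign (hF.represents_self.det p)

theorem eps_sq (hF : IsLocalRiemannian U F) (p : U) : eps F p ^ 2 = 1 :=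
  sign_sq (hF.nondegenerate p p.2)

theorem eps_div_sqrt (p : U) : eps F p / √(eps F p * (metric F p).det) =
    eps F p * hF.riemannianCalculus.w.1 p := by
  have h : hF.riemannianCalculus.w.1 p = (√|(metric F p).det|)⁻¹ :=
    congrArg (fun x => (√|x|)⁻¹) (hF.represents_self.det p).symm
  rw [eps, sign_mul_self_eq_abs, h, div_eq_mul_inv]

theorem mul_dy (p : U) (i : Fin 2) : F p * dy i F p = (hF.riemannianCalculus.low i).1 p := by
  have h := hF.Y_sq i
  simp only [Derivation.leibniz_pow, smul_eq_mul, nsmul_eq_mul,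
    Nat.cast_ofNat, pow_one, Nat.add_one_sub_one] at h
  have h' : hF.toSmoothFun * (coordCalculus U).Y i hF.toSmoothFun =
      hF.riemannianCalculus.low i := by
    rw [← sub_eq_zero]
    apply eq_zero_of_two_mul
    rw [mul_sub, sub_eq_zero]
    exact h
  rw [hF.represents_self.dy i p, ← h']
  rfl

theorem mUp_zero (p : U) :
    F p * mUp F 0 p = eps F p * (hF.riemannianCalculus.J 0).1 p := by
  simp only [mUp, hF.eps_div_sqrt, ellDown, RiemannianCalculus.J, Matrix.cons_val_zero]
  change _ = eps F p * -(hF.riemannianCalculus.w.1 p * (hF.riemannianCalculus.low 1).1 p)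
  rw [← hF.mul_dy]; ring

theorem mUp_one (p : U) :
    F p * mUp F 1 p = eps F p * (hF.riemannianCalculus.J 1).1 p := by
  simp only [mUp, hF.eps_div_sqrt, ellDown, RiemannianCalculus.J, Matrix.cons_val_one]
  change _ = eps F p * (hF.riemannianCalculus.w.1 p * (hF.riemannianCalculus.low 0).1 p)
  rw [← hF.mul_dy]
  simp; ring

variable {f : Plane × Plane → ℝ} {a : SmoothFun U}

theorem represents_v2 (h : Represents f a) :
    Represents (v2 F f) (hF.riemannianCalculus.D a) := fun p => by
  have h0 := hF.mUp_zero p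
  have h1 := hF.mUp_one p
  have hs := hF.eps_sq p
  rw [v2, Fin.sum_univ_two, h.dy 0 p, h.dy 1 p, RiemannianCalculus.D_apply]
  change _ = (hF.riemannianCalculus.J 0).1 p * ((coordCalculus U).Y 0 a).1 p +
    (hF.riemannianCalculus.J 1).1 p * ((coordCalculus U).Y 1 a).1 p
  linear_combination eps F p * ((coordCalculus U).Y 0 a).1 p * h0 +
    eps F p * ((coordCalculus U).Y 1 a).1 p * h1 +
    (((coordCalculus U).Y 0 a).1 p * (hF.riemannianCalculus.J 0).1 p +
      ((coordCalculus U).Y 1 a).1 p * (hF.riemannianCalculus.J 1).1 p) * hs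

theorem represents_spray (i : Fin 2) :
    Represents (spray F i) ((1 / 4 : ℝ) • hF.riemannianCalculus.N i) := fun p => by
  refine spray_eq_of_metric_mul (N := fun i => (hF.riemannianCalculus.N i).1 p)
    (hF.nondegenerate p p.2) (fun j => ?_) i
  have hr := hF.represents_self
  have e (i j : Fin 2) : metric F p i j = (hF.riemannianCalculus.g i j).1 p := hr.metric i j p
  rw [e, e, (hr.sq.dy j).dx 0 p, (hr.sq.dy j).dx 1 p, hr.sq.dx j p]
  exact congrArg (fun f : SmoothFun U => f.1 p) (hF.riemannianCalculus.metric_mul_N j)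

theorem represents_barthel (j i : Fin 2) :
    Represents (barthel F j i)
      ((1 / 4 : ℝ) • (coordCalculus U).Y i (hF.riemannianCalculus.N j)) := by
  have := (hF.represents_spray j).dy i
  rwa [Derivation.map_smul] at this

theorem delta_eq (h : Represents f a) (p : U) (i : Fin 2) :
    4 * delta F i f p = 4 * ((coordCalculus U).X i a).1 p -
      (((coordCalculus U).Y i (hF.riemannianCalculus.N 0)).1 p * ((coordCalculus U).Y 0 a).1 p +
      ((coordCalculus U).Y i (hF.riemannianCalculus.N 1)).1 p * ((coordCalculus U).Y 1 a).1 p) := by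
  have e (j : Fin 2) : barthel F j i p =
      1 / 4 * ((coordCalculus U).Y i (hF.riemannianCalculus.N j)).1 p := hF.represents_barthel j i p
  rw [delta, Fin.sum_univ_two, h.dx i p, h.dy 0 p, h.dy 1 p, e, e]
  ring

theorem represents_h1 (h : Represents f a) :
    Represents (h1 F f) ((1 / 2 : ℝ) • (hF.riemannianCalculus.T a * hF.invFun)) := fun p => by
  have h0 := hF.delta_eq h p 0
  have h1' := hF.delta_eq h p 1
  have n0 := congrArg (fun f : SmoothFun U => f.1 p) (hF.riemannianCalculus.euler_N 0)
  have n1 := congrArg (fun f : SmoothFun U => f.1 p) (hF.riemannianCalculus.euler_N 1)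
  simp only [RiemannianCalculus.euler_apply] at n0 n1
  change p.1.2 0 * ((coordCalculus U).Y 0 _).1 p + p.1.2 1 * ((coordCalculus U).Y 1 _).1 p =
    2 * _ at n0 n1
  rw [h1, Fin.sum_univ_two, ellUp, ellUp, RiemannianCalculus.T_apply]
  change _ = 1 / 2 * ((2 * p.1.2 0 * ((coordCalculus U).X 0 a).1 p +
    2 * p.1.2 1 * ((coordCalculus U).X 1 a).1 p -
    (hF.riemannianCalculus.N 0).1 p * ((coordCalculus U).Y 0 a).1 p -
    (hF.riemannianCalculus.N 1).1 p * ((coordCalculus U).Y 1 a).1 p) * hF.invFun.1 p)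
  rw [hF.invFun_apply, div_eq_mul_inv, div_eq_mul_inv]
  linear_combination (1 / 4) * (F p)⁻¹ * (p.1.2 0 * h0 + p.1.2 1 * h1'
    - ((coordCalculus U).Y 0 a).1 p * n0 - ((coordCalculus U).Y 1 a).1 p * n1)

theorem represents_h2 (h : Represents f a) :
    Represents (h2 F f) ((1 / 2 : ℝ) • (hF.riemannianCalculus.H a * hF.invFun)) := fun p => by
  have h0 := hF.delta_eq h p 0
  have h1' := hF.delta_eq h p 1
  have n0 := congrArg (fun f : SmoothFun U => f.1 p) (hF.riemannianCalculus.two_mul_T_J 0)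
  have n1 := congrArg (fun f : SmoothFun U => f.1 p) (hF.riemannianCalculus.two_mul_T_J 1)
  simp only [RiemannianCalculus.D_apply] at n0 n1
  change 2 * _ = -((hF.riemannianCalculus.J 0).1 p * ((coordCalculus U).Y 0 _).1 p +
    (hF.riemannianCalculus.J 1).1 p * ((coordCalculus U).Y 1 _).1 p) at n0 n1
  have m0 := hF.mUp_zero p
  have m1 := hF.mUp_one p
  have hs := hF.eps_sq p
  have hne := hF.ne_zero p.2
  rw [h2, Fin.sum_univ_two, RiemannianCalculus.H_apply]
  change _ = 1 / 2 * ((2 * (hF.riemannianCalculus.J 0).1 p * ((coordCalculus U).X 0 a).1 p +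
    2 * (hF.riemannianCalculus.J 1).1 p * ((coordCalculus U).X 1 a).1 p +
    (hF.riemannianCalculus.T (hF.riemannianCalculus.J 0)).1 p * ((coordCalculus U).Y 0 a).1 p +
    (hF.riemannianCalculus.T (hF.riemannianCalculus.J 1)).1 p * ((coordCalculus U).Y 1 a).1 p)
      * hF.invFun.1 p)
  rw [hF.invFun_apply]
  replace m0 : mUp F 0 p = (F p)⁻¹ * (eps F p * (hF.riemannianCalculus.J 0).1 p) := by
    rw [← m0]; field_simp
  replace m1 : mUp F 1 p = (F p)⁻¹ * (eps F p * (hF.riemannianCalculus.J 1).1 p) := by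
    rw [← m1]; field_simp
  rw [m0, m1]
  linear_combination (F p)⁻¹ * (delta F 0 f p * (hF.riemannianCalculus.J 0).1 p +
      delta F 1 f p * (hF.riemannianCalculus.J 1).1 p) * hs +
    1 / 4 * (F p)⁻¹ * ((hF.riemannianCalculus.J 0).1 p * h0 +
      (hF.riemannianCalculus.J 1).1 p * h1' - ((coordCalculus U).Y 0 a).1 p * n0 -
      ((coordCalculus U).Y 1 a).1 p * n1)

theorem D_toSmoothFun : hF.riemannianCalculus.D hF.toSmoothFun = 0 := by
  have h := hF.riemannianCalculus.D_L
  change hF.riemannianCalculus.D (hF.toSmoothFun ^ 2) = 0 at h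
  simp only [Derivation.leibniz_pow, smul_eq_mul, nsmul_eq_mul,
    Nat.cast_ofNat, pow_one, Nat.add_one_sub_one] at h
  replace h := eq_zero_of_two_mul h
  linear_combination hF.invFun * h - hF.riemannianCalculus.D hF.toSmoothFun * hF.mul_invFun

theorem D_invFun : hF.riemannianCalculus.D hF.invFun = 0 := by
  have h := congrArg hF.riemannianCalculus.D hF.mul_invFun
  rw [Derivation.leibniz, D_toSmoothFun, smul_zero, add_zero, smul_eq_mul,
    Derivation.map_one_eq_zero] at h
  linear_combination hF.invFun * h - hF.riemannianCalculus.D hF.invFun * hF.mul_invFun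

/-- `φ_{;2;2} + (φ_{;2})² + ε` for the function `a = φ`. -/
def kappa (a : SmoothFun U) : SmoothFun U :=
  hF.riemannianCalculus.D (hF.riemannianCalculus.D a) + hF.riemannianCalculus.D a ^ 2 +
    hF.riemannianCalculus.ε

theorem represents_changeDiscriminant (h : Represents f a)
    (hf : ∀ p ∈ U, ∀ c : ℝ, 0 < c → f (p.1, c • p.2) = f p) :
    Represents (changeDiscriminant F f) (hF.kappa a) := fun p => by
  have he : hF.riemannianCalculus.euler a = 0 := by
    have := euler_of_homogeneous h (r := 0) (fun p hp c hc => by simpa using hf p hp c hc)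
    rw [RiemannianCalculus.euler_apply]
    exact this.trans (by simp)
  have h0 := congrArg (fun f : SmoothFun U => f.1 p) (hF.riemannianCalculus.hessian_J_J a)
  rw [he, mul_zero, add_zero] at h0
  change (hF.riemannianCalculus.J 0).1 p * ((hF.riemannianCalculus.J 0).1 p *
      ((coordCalculus U).Y 0 ((coordCalculus U).Y 0 a)).1 p + (hF.riemannianCalculus.J 1).1 p *
      ((coordCalculus U).Y 1 ((coordCalculus U).Y 0 a)).1 p) +
    (hF.riemannianCalculus.J 1).1 p * ((hF.riemannianCalculus.J 0).1 p *
      ((coordCalculus U).Y 0 ((coordCalculus U).Y 1 a)).1 p + (hF.riemannianCalculus.J 1).1 p *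
      ((coordCalculus U).Y 1 ((coordCalculus U).Y 1 a)).1 p) = _ at h0
  have h1 : (hF.riemannianCalculus.D a).1 p =
      (hF.riemannianCalculus.J 0).1 p * ((coordCalculus U).Y 0 a).1 p +
      (hF.riemannianCalculus.J 1).1 p * ((coordCalculus U).Y 1 a).1 p := by
    rw [RiemannianCalculus.D_apply]; rfl
  have m0 := hF.mUp_zero p
  have m1 := hF.mUp_one p
  have hs := hF.eps_sq p
  have e (i j : Fin 2) : dy i (dy j f) p = ((coordCalculus U).Y i ((coordCalculus U).Y j a)).1 p :=
    (h.dy j).dy i p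
  have e' (i : Fin 2) : dy i f p = ((coordCalculus U).Y i a).1 p := h.dy i p
  have hr : (hF.kappa a).1 p = (hF.riemannianCalculus.D (hF.riemannianCalculus.D a)).1 p +
    (hF.riemannianCalculus.D a).1 p ^ 2 + hF.riemannianCalculus.ε.1 p := rfl
  rw [hr, h1, ← h0, ← hF.eps_eq, changeDiscriminant]
  simp only [Fin.sum_univ_two, e, e']
  exact discriminant_identity m0 m1 hs

theorem mainScalar_eq_zero (hF : IsLocalRiemannian U F) {p : Plane × Plane} (hp : p ∈ U) :
    mainScalar F p = 0 := by
  simp [mainScalar, hF.cartan_eq_zero p hp]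

end IsLocalRiemannian

/-- `φ` is the expression, on an open set `U` of induced coordinates, of the factor of an
anisotropic conformal change of `F`. -/
structure IsLocalConformalFactor (U : Opens (Plane × Plane)) (F φ : Plane × Plane → ℝ) : Prop where
  smooth : ContDiffOn ℝ ∞ φ U
  homogeneous : ∀ p ∈ U, ∀ c : ℝ, 0 < c → φ (p.1, c • p.2) = φ p
  discriminant_ne_zero : ∀ p ∈ U, changeDiscriminant F φ p ≠ 0

namespace IsLocalConformalFactor

variable {φ : Plane × Plane → ℝ} (hφ : IsLocalConformalFactor U F φ) (hF : IsLocalRiemannian U F)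

theorem kappa_ne_zero (p : U) : (hF.kappa (SmoothFun.of φ hφ.smooth)).1 p ≠ 0 := by
  rw [← hF.represents_changeDiscriminant (SmoothFun.represents_of φ hφ.smooth) hφ.homogeneous p]
  exact hφ.discriminant_ne_zero p p.2

theorem fderiv_exp_two_mul (hφ : IsLocalConformalFactor U F φ) (p : U) (v : Plane × Plane) :
    fderiv ℝ (fun q => Real.exp (2 * φ q)) p v =
      2 * Real.exp (2 * φ p) * fderiv ℝ φ p v := by
  have h := (SmoothFun.represents_of φ hφ.smooth).differentiableAt p
  rw [fderiv_exp (h.const_mul 2), fderiv_const_mul h]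
  simp
  ring

/-- The calculus of the change `F ↦ e^φ F`. -/
def conformalCalculus : ConformalCalculus (SmoothFun U) where
  __ := hF.riemannianCalculus
  φ := SmoothFun.of φ hφ.smooth
  v := SmoothFun.of (fun q => Real.exp (2 * φ q)) ((contDiffOn_const.mul hφ.smooth).exp)
  ρ := SmoothFun.comp (hF.kappa (SmoothFun.of φ hφ.smooth)) (hφ.kappa_ne_zero hF) _
    contDiffOn_inv_compl
  euler_φ := by
    have := euler_of_homogeneous (SmoothFun.represents_of φ hφ.smooth) (r := 0)
      (fun p hp c hc => by simpa using hφ.homogeneous p hp c hc)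
    rw [RiemannianCalculus.euler_apply]
    exact this.trans (by simp)
  X_v i := SmoothFun.ext_represents ((SmoothFun.represents_of _ _).dx i) fun p =>
    (hφ.fderiv_exp_two_mul p _).trans (congrArg (2 * Real.exp (2 * φ p) * ·)
      ((SmoothFun.represents_of φ hφ.smooth).dx i p))
  Y_v i := SmoothFun.ext_represents ((SmoothFun.represents_of _ _).dy i) fun p =>
    (hφ.fderiv_exp_two_mul p _).trans (congrArg (2 * Real.exp (2 * φ p) * ·)
      ((SmoothFun.represents_of φ hφ.smooth).dy i p))
  ρ_mul := by
    ext p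
    exact mul_inv_cancel₀ (hφ.kappa_ne_zero hF p)

end IsLocalConformalFactor

end ConicFinsler

/-! ### The Douglas tensor in coordinates -/

namespace ConicFinsler

open TopologicalSpace (Opens)

variable {U : Opens (Plane × Plane)} {F φ : Plane × Plane → ℝ}

namespace IsLocalConformalFactor

variable (hφ : IsLocalConformalFactor U F φ) (hF : IsLocalRiemannian U F)

theorem represents_φ : Represents φ (hφ.conformalCalculus hF).φ := fun _ => rfl

theorem rho_eq (p : U) : rho F φ p = (hφ.conformalCalculus hF).ρ.1 p := by
  have h := hφ.represents_φ hF
  have e1 : v2 F φ p = ((hφ.conformalCalculus hF).D (hφ.conformalCalculus hF).φ).1 p :=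
    hF.represents_v2 h p
  have e2 : v2 F (v2 F φ) p = ((hφ.conformalCalculus hF).D
      ((hφ.conformalCalculus hF).D (hφ.conformalCalculus hF).φ)).1 p :=
    hF.represents_v2 (hF.represents_v2 h) p
  have e3 : eps F p = (hφ.conformalCalculus hF).ε.1 p := hF.eps_eq p
  have e4 : (hφ.conformalCalculus hF).ρ.1 p = (((hφ.conformalCalculus hF).D
      ((hφ.conformalCalculus hF).D (hφ.conformalCalculus hF).φ)).1 p +
      ((hφ.conformalCalculus hF).D (hφ.conformalCalculus hF).φ).1 p ^ 2 +
      (hφ.conformalCalculus hF).ε.1 p)⁻¹ := rfl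
  rw [e4, rho, sigma, hF.mainScalar_eq_zero p.2, e1, e2, e3, one_div]
  congr 1
  ring

/-- `Q = ε F β / 4`. -/
theorem represents_Q : Represents (Q F φ) ((1 / 4 : ℝ) • ((hφ.conformalCalculus hF).ε *
    hF.toSmoothFun * (hφ.conformalCalculus hF).β)) := fun p => by
  have h := hφ.represents_φ hF
  have hne := hF.ne_zero p.2
  have e1 : v2 F φ p = ((hφ.conformalCalculus hF).D (hφ.conformalCalculus hF).φ).1 p :=
    hF.represents_v2 h p
  have e2 : h1 F φ p = 1 / 2 * (((hφ.conformalCalculus hF).T (hφ.conformalCalculus hF).φ).1 p *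
      hF.invFun.1 p) := hF.represents_h1 h p
  have e3 : h2 F φ p = 1 / 2 * (((hφ.conformalCalculus hF).H (hφ.conformalCalculus hF).φ).1 p *
      hF.invFun.1 p) := hF.represents_h2 h p
  have e4 : v2 F (h1 F φ) p = 1 / 2 * ((((hφ.conformalCalculus hF).T
      ((hφ.conformalCalculus hF).D (hφ.conformalCalculus hF).φ)).1 p +
      ((hφ.conformalCalculus hF).H (hφ.conformalCalculus hF).φ).1 p) * hF.invFun.1 p) := by
    have e : hF.riemannianCalculus.D ((1 / 2 : ℝ) •
        (hF.riemannianCalculus.T (hφ.conformalCalculus hF).φ * hF.invFun)) = (1 / 2 : ℝ) •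
        ((hF.riemannianCalculus.T (hF.riemannianCalculus.D (hφ.conformalCalculus hF).φ) +
        hF.riemannianCalculus.H (hφ.conformalCalculus hF).φ) * hF.invFun) := by
      rw [Derivation.map_smul, Derivation.leibniz, hF.D_invFun, smul_zero, zero_add,
        RiemannianCalculus.D_T, smul_eq_mul, mul_comm]
    have := hF.represents_v2 (hF.represents_h1 h) p
    rw [e] at this
    exact this
  have e5 : eps F p = (hφ.conformalCalculus hF).ε.1 p := hF.eps_eq p
  have e6 : ((1 / 4 : ℝ) • ((hφ.conformalCalculus hF).ε *
    hF.toSmoothFun * (hφ.conformalCalculus hF).β)).1 p =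
    1 / 4 * ((hφ.conformalCalculus hF).ε.1 p * F p * ((hφ.conformalCalculus hF).ρ.1 p *
      (((hφ.conformalCalculus hF).D (hφ.conformalCalculus hF).φ).1 p *
        ((hφ.conformalCalculus hF).T (hφ.conformalCalculus hF).φ).1 p +
        ((hφ.conformalCalculus hF).T
          ((hφ.conformalCalculus hF).D (hφ.conformalCalculus hF).φ)).1 p -
        ((hφ.conformalCalculus hF).H (hφ.conformalCalculus hF).φ).1 p))) := rfl
  rw [e6, Q, e1, e2, e3, e4, hφ.rho_eq hF, e5, hF.invFun_apply]
  field_simp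
  ring

/-- As `D F = 0` and `D ε = 0`, the fourth order equation for `Q` is that for `β`. -/
theorem equation_eq (p : U) :
    9 * eps F p * Q F φ p + 10 * v2 F (v2 F (Q F φ)) p
      + eps F p * v2 F (v2 F (v2 F (v2 F (Q F φ)))) p =
    1 / 4 * F p * (9 * (hφ.conformalCalculus hF).β +
      10 * (hφ.conformalCalculus hF).ε * (hφ.conformalCalculus hF).D
        ((hφ.conformalCalculus hF).D (hφ.conformalCalculus hF).β) +
      (hφ.conformalCalculus hF).D ((hφ.conformalCalculus hF).D ((hφ.conformalCalculus hF).D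
        ((hφ.conformalCalculus hF).D (hφ.conformalCalculus hF).β)))).1 p := by
  have hQ := hφ.represents_Q hF
  have hD (b : SmoothFun U) : hF.riemannianCalculus.D ((1 / 4 : ℝ) •
      ((hφ.conformalCalculus hF).ε * hF.toSmoothFun * b)) = (1 / 4 : ℝ) •
      ((hφ.conformalCalculus hF).ε * hF.toSmoothFun * (hφ.conformalCalculus hF).D b) := by
    have e1 : hF.riemannianCalculus.D (hφ.conformalCalculus hF).ε = 0 :=
      hF.riemannianCalculus.derivation_ε _
    rw [Derivation.map_smul, Derivation.leibniz, Derivation.leibniz, e1, hF.D_toSmoothFun]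
    simp only [mul_zero, add_zero, smul_eq_mul]
    rfl
  have h1 := hF.represents_v2 hQ
  have h2 := hF.represents_v2 h1
  have h3 := hF.represents_v2 h2
  have h4 := hF.represents_v2 h3
  rw [hD, hD, hD, hD] at h4
  rw [hD, hD] at h2
  have hs := hF.eps_sq p
  have e5 : eps F p = (hφ.conformalCalculus hF).ε.1 p := hF.eps_eq p
  rw [hQ p, h2 p, h4 p]
  have e (b : SmoothFun U) : ((1 / 4 : ℝ) •
      ((hφ.conformalCalculus hF).ε * hF.toSmoothFun * b)).1 p =
      1 / 4 * (eps F p * F p * b.1 p) := by rw [e5]; rfl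
  have e' (a b d : SmoothFun U) : (9 * a + 10 * (hφ.conformalCalculus hF).ε * b + d).1 p =
      9 * a.1 p + 10 * eps F p * b.1 p + d.1 p := by rw [e5]; rfl
  rw [e, e, e, e']
  linear_combination 1 / 4 * F p * (9 * (hφ.conformalCalculus hF).β.1 p +
    ((hφ.conformalCalculus hF).D ((hφ.conformalCalculus hF).D ((hφ.conformalCalculus hF).D
      ((hφ.conformalCalculus hF).D (hφ.conformalCalculus hF).β)))).1 p) * hs

theorem represents_sq : Represents (fun p => (Real.exp (φ p) * F p) ^ 2)
    ((hφ.conformalCalculus hF).v * (hφ.conformalCalculus hF).L) := fun p => by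
  change (Real.exp (φ p) * F p) ^ 2 = Real.exp (2 * φ p) * F p ^ 2
  rw [mul_pow, ← Real.exp_nat_mul]
  norm_num

theorem metric_eq (p : U) (i j : Fin 2) : metric (fun p => Real.exp (φ p) * F p) p i j =
    1 / 2 * ((coordCalculus U).Y i ((coordCalculus U).Y j
      ((hφ.conformalCalculus hF).v * (hφ.conformalCalculus hF).L))).1 p := by
  rw [← ((hφ.represents_sq hF).dy j).dy i p]
  rfl

theorem area_ne_zero (p : U) : ((hφ.conformalCalculus hF).y 0 * (hφ.conformalCalculus hF).J 1 -
    (hφ.conformalCalculus hF).y 1 * (hφ.conformalCalculus hF).J 0).1 p ≠ 0 := by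
  intro h
  have h1 := congrArg (fun f : SmoothFun U => f.1 p) (hφ.conformalCalculus hF).area_mul
  change _ * _ = (1 : ℝ) at h1
  rw [h, zero_mul] at h1
  exact zero_ne_one h1

theorem metric_det_ne_zero (hφ : IsLocalConformalFactor U F φ) (hF : IsLocalRiemannian U F)
    (p : U) :
    (metric (fun p => Real.exp (φ p) * F p) p).det ≠ 0 := by
  have h := congrArg (fun f : SmoothFun U => f.1 p) (hφ.conformalCalculus hF).det_hessian_vL
  have hκ := hφ.kappa_ne_zero hF p
  have hL : (Real.exp (2 * φ p) * F p ^ 2) ^ 2 ≠ 0 :=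
    pow_ne_zero 2 (mul_ne_zero (Real.exp_ne_zero _) (pow_ne_zero 2 (hF.ne_zero p.2)))
  rw [Matrix.det_fin_two]
  simp only [hφ.metric_eq hF]
  rw [(coordCalculus U).Y_Y 1 0]
  intro h0
  change ((((coordCalculus U).Y 0 ((coordCalculus U).Y 0 _)).1 p *
    ((coordCalculus U).Y 1 ((coordCalculus U).Y 1 _)).1 p -
    ((coordCalculus U).Y 0 ((coordCalculus U).Y 1 _)).1 p ^ 2)) * _ =
    4 * (Real.exp (2 * φ p) * F p ^ 2) ^ 2 *
      (hF.kappa (SmoothFun.of φ hφ.smooth)).1 p at h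
  refine mul_ne_zero (mul_ne_zero four_ne_zero hL) hκ (h.symm.trans ?_)
  refine mul_eq_zero_of_left ?_ _
  linear_combination 4 * h0

theorem represents_spray_change (i : Fin 2) :
    Represents (spray (fun p => Real.exp (φ p) * F p) i)
      ((1 / 4 : ℝ) • (hφ.conformalCalculus hF).N' i) := fun p => by
  refine spray_eq_of_metric_mul (N := fun i => ((hφ.conformalCalculus hF).N' i).1 p)
    (hφ.metric_det_ne_zero hF p) (fun j => ?_) i
  have h := congrArg (fun f : SmoothFun U => f.1 p) ((hφ.conformalCalculus hF).spray_equation j)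
  have hr := hφ.represents_sq hF
  simp only [hφ.metric_eq hF]
  rw [(hr.dy j).dx 0 p, (hr.dy j).dx 1 p, hr.dx j p, (coordCalculus U).Y_Y j 0,
    (coordCalculus U).Y_Y j 1]
  change ((hφ.conformalCalculus hF).N' 0).1 p *
      ((coordCalculus U).Y 0 ((coordCalculus U).Y j _)).1 p +
    ((hφ.conformalCalculus hF).N' 1).1 p *
      ((coordCalculus U).Y 1 ((coordCalculus U).Y j _)).1 p =
    2 * (p.1.2 0 * ((coordCalculus U).X 0 ((coordCalculus U).Y j _)).1 p +
      p.1.2 1 * ((coordCalculus U).X 1 ((coordCalculus U).Y j _)).1 p -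
      ((coordCalculus U).X j _).1 p) at h
  linear_combination 1 / 2 * h

theorem represents_douglas (i j k l : Fin 2) :
    Represents (douglas (fun p => Real.exp (φ p) * F p) i j k l)
      ((1 / 12 : ℝ) • (coordCalculus U).Y j ((coordCalculus U).Y k ((coordCalculus U).Y l
        (3 * (hφ.conformalCalculus hF).N' i - ((coordCalculus U).Y 0
          ((hφ.conformalCalculus hF).N' 0) + (coordCalculus U).Y 1
          ((hφ.conformalCalculus hF).N' 1)) * (coordCalculus U).y i)))) := by
  have h := hφ.represents_spray_change hF
  have hP : Represents (fun q => spray (fun p => Real.exp (φ p) * F p) i q -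
      (1 / 3) * (∑ r, dy r (spray (fun p => Real.exp (φ p) * F p) r) q) * q.2 i)
      ((1 / 12 : ℝ) • (3 * (hφ.conformalCalculus hF).N' i - ((coordCalculus U).Y 0
          ((hφ.conformalCalculus hF).N' 0) + (coordCalculus U).Y 1
          ((hφ.conformalCalculus hF).N' 1)) * (coordCalculus U).y i)) := fun p => by
    have e := h i p
    have e' (r : Fin 2) := (h r).dy r p
    simp only [Derivation.map_smul] at e'
    beta_reduce
    rw [Fin.sum_univ_two, e, e', e']
    change 1 / 4 * ((hφ.conformalCalculus hF).N' i).1 p -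
      1 / 3 * (1 / 4 * ((coordCalculus U).Y 0 _).1 p +
        1 / 4 * ((coordCalculus U).Y 1 _).1 p) * p.1.2 i =
      1 / 12 * (3 * ((hφ.conformalCalculus hF).N' i).1 p -
      (((coordCalculus U).Y 0 _).1 p + ((coordCalculus U).Y 1 _).1 p) * p.1.2 i)
    ring
  have := ((hP.dy l).dy k).dy j
  simp only [Derivation.map_smul] at this
  exact this

end IsLocalConformalFactor

/-- The equivalence holds pointwise in each chart. -/
theorem douglas_eq_zero_iff (hφ : IsLocalConformalFactor U F φ) (hF : IsLocalRiemannian U F)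
    (p : U) (hy : p.1.2 ≠ 0) :
    (∀ i j k l, douglas (fun p => Real.exp (φ p) * F p) i j k l p = 0) ↔
      9 * eps F p * Q F φ p + 10 * v2 F (v2 F (Q F φ)) p
        + eps F p * v2 F (v2 F (v2 F (v2 F (Q F φ)))) p = 0 := by
  rw [hφ.equation_eq hF]
  generalize hΦ : (9 * (hφ.conformalCalculus hF).β +
      10 * (hφ.conformalCalculus hF).ε * (hφ.conformalCalculus hF).D
        ((hφ.conformalCalculus hF).D (hφ.conformalCalculus hF).β) +
      (hφ.conformalCalculus hF).D ((hφ.conformalCalculus hF).D ((hφ.conformalCalculus hF).D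
        ((hφ.conformalCalculus hF).D (hφ.conformalCalculus hF).β)))) = Φ
  have key (i j k l : Fin 2) : douglas (fun p => Real.exp (φ p) * F p) i j k l p = 0 ↔
      ![-p.1.2 1, p.1.2 0] j * ![-p.1.2 1, p.1.2 0] k * ![-p.1.2 1, p.1.2 0] l * p.1.2 i *
        Φ.1 p = 0 := by
    have h := congrArg (fun f : SmoothFun U => f.1 p)
      ((hφ.conformalCalculus hF).third_P i j k l)
    rw [hΦ] at h
    have hn (j : Fin 2) : ((![-(hφ.conformalCalculus hF).y 1, (hφ.conformalCalculus hF).y 0] :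
        Fin 2 → SmoothFun U) j).1 p = ![-p.1.2 1, p.1.2 0] j := by
      fin_cases j <;> rfl
    have hA := hφ.area_ne_zero hF p
    rw [hφ.represents_douglas hF i j k l p]
    change ((hφ.conformalCalculus hF).y 0 * (hφ.conformalCalculus hF).J 1 -
      (hφ.conformalCalculus hF).y 1 * (hφ.conformalCalculus hF).J 0).1 p ^ 3 *
      ((coordCalculus U).Y j _).1 p = -(_ * _ * _ * p.1.2 i * _) at h
    rw [hn, hn, hn] at h
    change 1 / 12 * ((coordCalculus U).Y j _).1 p = 0 ↔ _
    constructor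
    · intro h0
      have h1 := (mul_eq_zero.1 h0).resolve_left (by norm_num)
      rw [← neg_eq_zero, ← h]
      exact mul_eq_zero_of_right _ h1
    · intro h0
      rw [h0, neg_zero] at h
      have h1 := (mul_eq_zero.1 h).resolve_left (pow_ne_zero 3 hA)
      exact mul_eq_zero_of_right _ h1
  simp only [key]
  constructor
  · intro h
    have : p.1.2 0 ≠ 0 ∨ p.1.2 1 ≠ 0 := by
      by_contra! h0
      apply hy
      ext i
      fin_cases i
      · exact h0.1
      · exact h0.2
    rcases this with h0 | h0
    -- If `y^0 ≠ 0`, the covector `(-y^1, y^0)` is non-zero on the index `1`.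
    · have := h 0 1 1 1
      simp [h0] at this
      simp [this]
    · have := h 1 0 0 0
      simp [h0] at this
      simp [this]
  · intro h i j k l
    have := (mul_eq_zero.1 h).resolve_left
      (mul_ne_zero (by norm_num) (hF.ne_zero p.2))
    rw [this, mul_zero]

end ConicFinsler

/-! ### Induced coordinates on the tangent bundle -/

namespace ConicFinsler

open TopologicalSpace (Opens)

variable {M : Type*} [TopologicalSpace M] [ChartedSpace Plane M]
  {e : OpenPartialHomeomorph M Plane}

theorem tangentPoint_smul (e : OpenPartialHomeomorph M Plane) (p : Plane × Plane) (c : ℝ) :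
    tangentPoint e (p.1, c • p.2) = scale c (tangentPoint e p) := by
  simp only [tangentPoint, scale]
  congr 1
  exact (mfderiv (𝓡 2) (𝓡 2) e.symm p.1).map_smul c p.2

theorem localRep_smul {A : Set (TangentBundle (𝓡 2) M)} {f : TangentBundle (𝓡 2) M → ℝ} {r : ℕ}
    (hf : IsPosHomogeneousOn r f A) {p : Plane × Plane} (hp : p ∈ localDomain e A) {c : ℝ}
    (hc : 0 < c) : localRep e f (p.1, c • p.2) = c ^ r * localRep e f p := by
  rw [localRep, tangentPoint_smul]
  exact hf _ hp.2 c hc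

theorem snd_ne_zero_of_mem_localDomain {A : Set (TangentBundle (𝓡 2) M)}
    (hA : ∀ v ∈ A, v.2 ≠ 0) {p : Plane × Plane} (hp : p ∈ localDomain e A) : p.2 ≠ 0 := by
  intro h
  apply hA _ hp.2
  simp only [tangentPoint, h]
  exact map_zero _

variable [IsManifold (𝓡 2) ∞ M]

/-- The map from induced coordinates to the tangent bundle is smooth: it is the tangent map of the
inverse chart. -/
theorem contMDiffOn_tangentPoint (he : e ∈ IsManifold.maximalAtlas (𝓡 2) ∞ M) :
    ContMDiffOn 𝓘(ℝ, Plane × Plane) (𝓡 2).tangent ∞ (tangentPoint e) (Prod.fst ⁻¹' e.target) := by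
  have : IsManifold (𝓡 2) 1 M := IsManifold.of_le (n := ∞) (by simp)
  have h1 : ContMDiffOn (𝓡 2).tangent (𝓡 2).tangent ∞ (tangentMapWithin (𝓡 2) (𝓡 2) e.symm e.target)
      (Bundle.TotalSpace.proj ⁻¹' e.target) :=
    (contMDiffOn_symm_of_mem_maximalAtlas he).contMDiffOn_tangentMapWithin (by simp)
      e.open_target.uniqueMDiffOn
  have h2 : ContMDiff 𝓘(ℝ, Plane × Plane) (𝓡 2).tangent ∞
      (fun p : Plane × Plane => (tangentBundleModelSpaceHomeomorph (𝓡 2)).symm p) := by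
    have := contMDiff_tangentBundleModelSpaceHomeomorph_symm (I := 𝓡 2) (n := ∞)
    rw [modelWithCornersSelf_prod]
    exact this
  refine (ContMDiffOn.comp (g := tangentMapWithin (𝓡 2) (𝓡 2) e.symm e.target) h1
    (h2.contMDiffOn (s := Prod.fst ⁻¹' e.target)) fun p hp => hp).congr fun p hp => ?_
  change (⟨e.symm p.1, mfderiv (𝓡 2) (𝓡 2) e.symm p.1 p.2⟩ : TangentBundle (𝓡 2) M) =
    ⟨e.symm p.1, mfderivWithin (𝓡 2) (𝓡 2) e.symm e.target p.1 p.2⟩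
  rw [mfderivWithin_of_isOpen e.open_target hp]

theorem isOpen_localDomain (he : e ∈ IsManifold.maximalAtlas (𝓡 2) ∞ M)
    {A : Set (TangentBundle (𝓡 2) M)} (hA : IsOpen A) : IsOpen (localDomain e A) :=
  (contMDiffOn_tangentPoint he).continuousOn.isOpen_inter_preimage
    (e.open_target.preimage continuous_fst) hA

theorem contDiffOn_localRep (he : e ∈ IsManifold.maximalAtlas (𝓡 2) ∞ M)
    {A : Set (TangentBundle (𝓡 2) M)} {f : TangentBundle (𝓡 2) M → ℝ}
    (hf : ContMDiffOn (𝓡 2).tangent 𝓘(ℝ, ℝ) ∞ f A) :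
    ContDiffOn ℝ ∞ (localRep e f) (localDomain e A) :=
  contMDiffOn_iff_contDiffOn.1 <| ContMDiffOn.comp (g := f) (f := tangentPoint e) hf
    ((contMDiffOn_tangentPoint he).mono fun _ hp => hp.1) fun _ hp => hp.2

end ConicFinsler

end

theorem mainTheorem6 {M : Type*} [TopologicalSpace M] [ChartedSpace ConicFinsler.Plane M]
    [IsManifold (𝓡 2) ∞ M]
    (A : Set (TangentBundle (𝓡 2) M)) (F φ : TangentBundle (𝓡 2) M → ℝ)
    (hF : ConicFinsler.IsConicPseudoRiemannian A F)
    (hφ : ConicFinsler.IsAnisotropicConformalFactor A F φ) :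
    ConicFinsler.IsDouglas A (ConicFinsler.conformalChange F φ) ↔
      ∀ e ∈ IsManifold.maximalAtlas (𝓡 2) ∞ M, ∀ p ∈ ConicFinsler.localDomain e A,
        let F' := ConicFinsler.localRep e F
        let Q := ConicFinsler.Q F' (ConicFinsler.localRep e φ)
        let D := ConicFinsler.v2 F'
        9 * ConicFinsler.eps F' p * Q p + 10 * D (D Q) p
          + ConicFinsler.eps F' p * D (D (D (D Q))) p = 0 := by
  refine forall₂_congr fun e he => forall₂_congr fun p hp => ?_
  let U : TopologicalSpace.Opens (ConicFinsler.Plane × ConicFinsler.Plane) :=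
    ⟨ConicFinsler.localDomain e A, ConicFinsler.isOpen_localDomain he hF.conic.isOpen⟩
  have hF' : ConicFinsler.IsLocalRiemannian U (ConicFinsler.localRep e F) :=
    { smooth := ConicFinsler.contDiffOn_localRep he hF.smooth
      homogeneous := fun q hq c hc => by
        simpa using ConicFinsler.localRep_smul hF.homogeneous hq hc
      nondegenerate := hF.nondegenerate e he
      cartan_eq_zero := hF.cartan_eq_zero e he }
  have hφ' : ConicFinsler.IsLocalConformalFactor U (ConicFinsler.localRep e F)
      (ConicFinsler.localRep e φ) :=
    { smooth := ConicFinsler.contDiffOn_localRep he hφ.smooth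
      homogeneous := fun q hq c hc => by
        simpa using ConicFinsler.localRep_smul hφ.homogeneous hq hc
      discriminant_ne_zero := hφ.discriminant_ne_zero e he }
  exact ConicFinsler.douglas_eq_zero_iff hφ' hF' ⟨p, hp⟩
    (ConicFinsler.snd_ne_zero_of_mem_localDomain hF.conic.ne_zero hp)
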